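/- Let $n\ge 0$ and let $W(A_n)$ be the Coxeter group of type $A_n$ with generators $\sigma_1,\dots,\sigma_n$. Write $[a,b]=\sigma_a\sigma_{a+1}\cdots\sigma_b$ for $1\le a\le b\le n$. Let $w\in W(A_n)$ be a fully commutative element, given in its canonical form $$w=[i_1,j_1][i_2,j_2]\cdots[i_p,j_p],\qquad 0\le p\le n,\quad n\ge i_1>\dots>i_p\ge 1,\quad n\ge j_1>\dots>j_p\ge 1,\quad j_t\ge i_t\ (1\le t\le p).$$ *Diagrams.* Let $A=\{1,\dots,n+1\}$ be a top row and $B=\{1',\dots,(n+1)'\}$ a bottom row of dots, with the total order $1<\dots<n+1<1'<\dots<(n+1)'$ on $A\cup B$. A non-crossing diagram on $n+1$ strings is a set $D$ of arrows $(x,y)$ with $x<y$ in $A\cup B$ (tail $x$, head $y$) such that each dot is an endpoint of exactly one arrow and the arrows can be drawn in the rectangle bounded by the two rows without crossings. Let $E_i=\{(i,i+1),(i',(i+1)')\}\cup\{(k,k') : 1\le k\le n+1,\ k\ne i,i+1\}$ for $1\le i\le n$. The concatenation $D_1\ast D_2$ is obtained by placing $D_2$ below $D_1$ and deleting the circles produced.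 Let $\mathcal D=\mathcal D(w)$ be the concatenation, from top to bottom, of the $E_h$ over the letters $\sigma_h$ of the canonical word of $w$ (the identity diagram $\{(x,x')\}$ if $p=0$). For a diagram $D$ let $AD$ and $BD$ be the sets of arrows of $D$ with both endpoints in $A$, respectively in $B$, let $D^+=\{(x,y')\in D : x,y\in A,\ x<y\}$, let $\mathcal T$ and $\mathcal H$ denote the sets of tails and of heads of a set of arrows, and let $\mathcal I(D)=\mathcal T(AD)\cup\mathcal T(D^+)$ and $\mathcal J(D)=\{j\in A : (j+1)'\in\mathcal H(BD)\cup\mathcal H(D^+)\}$. The support of an element of $W(A_n)$ is the set of generators appearing in a reduced expression of it. An element is saturated in a standard parabolic subgroup $\langle\sigma_h : h\in J\rangle$ if it belongs to this subgroup and its support is $\{\sigma_h : h\in J\}$. Then $\mathcal D$ is a non-crossing diagram on $n+1$ strings, and: 1. $\mathcal I(\mathcal D)=\{i_k : 1\le k\le p\}$. 2. $\mathcal J(\mathcal D)=\{j_k : 1\le k\le p\}$. 3. $\mathcal D^+$ is the set of arrows $(i_s,(j_t+1)')$ with $1\le t<s\le p$ such that - $j_t=i_s+2(s-t)-1$; -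 for all $r$ with $t<r<s$: $j_r\ne i_s+2(s-r)-1$ and $j_t\ne i_r+2(r-t)-1$; - $\prod_{k=t+1}^{s-1}[i_k,j_k]$ is saturated in $\langle\sigma_h : i_s+1\le h\le j_t-1\rangle$. 4. If $p\ge1$, let $A(1)=\{i_1+1,\dots,j_1+1\}$ and, inductively for $1<r\le p$, let $A(r)=\emptyset$ if $i_r\in\mathcal T(\mathcal D^+)$ and otherwise $$A(r)=\{i_r+1,\dots,j_1+1\}\setminus\{i_1,\dots,i_{r-1}\}\setminus\{f_k : 1\le k\le r-1,\ A(k)\ne\emptyset\},$$ where $f_k=\min A(k)$ whenever $A(k)\neq\emptyset$. Then $A\mathcal D=\{(i_r,f_r) : 1\le r\le p,\ A(r)\ne\emptyset\}$ (the empty set if $p=0$). 5. If $p\ge1$, let $B(p)=\{i_p,\dots,j_p\}$ and, inductively for $r=p-1,\dots,1$, let $B(r)=\emptyset$ if $(j_r+1)'\in\mathcal H(\mathcal D^+)$ and otherwise $$B(r)=\{i_p,\dots,j_r\}\setminus\{j_p+1,\dots,j_{r+1}+1\}\setminus\{g_k : r+1\le k\le p,\ B(k)\ne\emptyset\},$$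 where $g_k=\max B(k)$ whenever $B(k)\neq\emptyset$. Then $B\mathcal D=\{(g_r',(j_r+1)') : 1\le r\le p,\ B(r)\ne\emptyset\}$ (the empty set if $p=0$). -/

import Mathlib

namespace FCDiagram

/-! ### Dots, arrows and non-crossing diagrams -/

/-- The dots of a diagram: `top x` is the dot `x` of the top row `A`, and `bot x` is the dot `x'` of
the bottom row `B`.  On `n + 1` strings only the numbers `1 ≤ x ≤ n + 1` are used. -/
inductive Dot : Type
  | top (x : ℕ) : Dot
  | bot (x : ℕ) : Dot

/-- The number of a dot in its row. -/
def Dot.num : Dot → ℕ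
  | .top x => x
  | .bot x => x

/-- The total order `1 < 2 < ⋯ < n + 1 < 1' < 2' < ⋯ < (n + 1)'`. -/
def Dot.Lt : Dot → Dot → Prop
  | .top x, .top y => x < y
  | .top _, .bot _ => True
  | .bot _, .top _ => False
  | .bot x, .bot y => x < y

/-- The dot belongs to `A ∪ B` for diagrams on `n + 1` strings. -/
def Dot.IsOn (n : ℕ) (d : Dot) : Prop := 1 ≤ d.num ∧ d.num ≤ n + 1

/-- The position of a dot when one runs around the boundary of the rectangle in the order
`1, 2, …, n + 1, (n + 1)', …, 2', 1'`. -/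
def Dot.pos (n : ℕ) : Dot → ℤ
  | .top x => x
  | .bot x => 2 * (n : ℤ) + 3 - x

/-- An arrow `(x, y)`, with tail `x` and head `y`. -/
abbrev Arrow : Type := Dot × Dot

/-- The dots `x` and `y` are joined in `D`. -/
def Joined (D : Set Arrow) (x y : Dot) : Prop := (x, y) ∈ D ∨ (y, x) ∈ D

/-- `D` is a non-crossing diagram on `n + 1` strings: a set of arrows `(x, y)` with `x < y` such that
each dot is joined to exactly one other dot and no two joins cross inside the rectangle. -/
structure IsDiagram (n : ℕ) (D : Set Arrow) : Prop where
  isOn : ∀ x y, (x, y) ∈ D → x.IsOn n ∧ y.IsOn n ∧ x.Lt y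
  matching : ∀ x : Dot, x.IsOn n → ∃! y, Joined D x y
  nonCrossing : ∀ a b c d, Joined D a b → Joined D c d →
    ¬ (a.pos n < c.pos n ∧ c.pos n < b.pos n ∧ b.pos n < d.pos n)

/-! ### Concatenation -/

/-- The dots of two stacked diagrams: the row (`0` top, `1` middle, `2` bottom) and the number. -/
abbrev StackDot : Type := Fin 3 × ℕ

/-- The place of a dot of the upper diagram in the stack. -/
def Dot.upper : Dot → StackDot
  | .top x => (0, x)
  | .bot x => (1, x)

/-- The place of a dot of the lower diagram in the stack. -/
def Dot.lower : Dot → StackDot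
  | .top x => (1, x)
  | .bot x => (2, x)

/-- The place of a dot of the concatenated diagram in the stack. -/
def Dot.outer : Dot → StackDot
  | .top x => (0, x)
  | .bot x => (2, x)

/-- Two dots of the stack are joined by an arrow of `D₁` (placed above) or of `D₂` (placed below). -/
def StackStep (D₁ D₂ : Set Arrow) (u v : StackDot) : Prop :=
  (∃ a ∈ D₁, u = a.1.upper ∧ v = a.2.upper) ∨ (∃ a ∈ D₂, u = a.1.lower ∧ v = a.2.lower)

/-- The concatenation `D₁ ∗ D₂`: place `D₂` below `D₁`, follow the joins from outer dot to outer dot,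
and forget the circles in the middle. -/
def concat (D₁ D₂ : Set Arrow) : Set Arrow :=
  {a | a.1.Lt a.2 ∧ Relation.EqvGen (StackStep D₁ D₂) a.1.outer a.2.outer}

/-- The identity diagram on `n + 1` strings. -/
def idDiagram (n : ℕ) : Set Arrow :=
  {a | ∃ k, 1 ≤ k ∧ k ≤ n + 1 ∧ a = (.top k, .bot k)}

/-- The diagram `E_i` on `n + 1` strings. -/
def E (n i : ℕ) : Set Arrow :=
  {(.top i, .top (i + 1)), (.bot i, .bot (i + 1))} ∪
    {a | ∃ k, ((1 ≤ k ∧ k + 1 ≤ i) ∨ (i + 2 ≤ k ∧ k ≤ n + 1)) ∧ a = (.top k, .bot k)}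

/-- The concatenation `E_{a₁} ∗ E_{a₂} ∗ ⋯ ∗ E_{aₘ}`, from top to bottom, of a word `a₁ a₂ ⋯ aₘ`. -/
def wordDiagram (n : ℕ) (ω : List ℕ) : Set Arrow :=
  ω.foldl (fun D a => concat D (E n a)) (idDiagram n)

/-! ### The components of a diagram -/

/-- `A D`: the arrows in the top row. -/
def topArrows (D : Set Arrow) : Set Arrow :=
  {a | a ∈ D ∧ ∃ x y, a = (.top x, .top y)}

/-- `B D`: the arrows in the bottom row. -/
def botArrows (D : Set Arrow) : Set Arrow :=
  {a | a ∈ D ∧ ∃ x y, a = (.bot x, .bot y)}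

/-- `D⁺`: the positive arrows from the top row to the bottom row. -/
def posArrows (D : Set Arrow) : Set Arrow :=
  {a | a ∈ D ∧ ∃ x y, x < y ∧ a = (.top x, .bot y)}

/-- The set of tails of a set of arrows. -/
def tails (X : Set Arrow) : Set Dot := {x | ∃ y, (x, y) ∈ X}

/-- The set of heads of a set of arrows. -/
def heads (X : Set Arrow) : Set Dot := {y | ∃ x, (x, y) ∈ X}

/-- `𝓘(D)`, for diagrams on `n + 1` strings. -/
def setI (n : ℕ) (D : Set Arrow) : Set ℕ :=
  {i | 1 ≤ i ∧ i ≤ n + 1 ∧ .top i ∈ tails (topArrows D ∪ posArrows D)}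

/-- `𝓙(D)`, for diagrams on `n + 1` strings. -/
def setJ (n : ℕ) (D : Set Arrow) : Set ℕ :=
  {j | 1 ≤ j ∧ j ≤ n + 1 ∧ .bot (j + 1) ∈ heads (botArrows D ∪ posArrows D)}

/-! ### Canonical forms of fully commutative elements of `W(A_n)` -/

/-- `n ≥ i₁ > ⋯ > i_p ≥ 1`, `n ≥ j₁ > ⋯ > j_p ≥ 1` and `j_t ≥ i_t`.
Only the values at `1, …, p` of the two sequences matter. -/
structure IsStandardPair (n p : ℕ) (i j : ℕ → ℕ) : Prop where
  size_le : p ≤ n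
  bounds : ∀ t, 1 ≤ t → t ≤ p → 1 ≤ i t ∧ i t ≤ j t ∧ j t ≤ n
  decr_i : ∀ s t, 1 ≤ s → s < t → t ≤ p → i t < i s
  decr_j : ∀ s t, 1 ≤ s → s < t → t ≤ p → j t < j s

/-- The word of `[i_a, j_a] [i_{a+1}, j_{a+1}] ⋯ [i_{b-1}, j_{b-1}]`, where `[x, y]` stands for
`x, x + 1, …, y`. -/
def blocksWord (i j : ℕ → ℕ) (a b : ℕ) : List ℕ :=
  (List.Ico a b).flatMap fun k => List.Ico (i k) (j k + 1)

/-- The diagram `𝓓(w)` of the element `w = [i₁, j₁] ⋯ [i_p, j_p]`. -/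
def diagram (n p : ℕ) (i j : ℕ → ℕ) : Set Arrow :=
  wordDiagram n (blocksWord i j 1 (p + 1))

/-! ### Support and saturation in a Coxeter group -/

/-- The support of `w`: the generators that appear in a reduced expression of `w`. -/
def support {B W : Type*} [Group W] {M : CoxeterMatrix B} (cs : CoxeterSystem M W) (w : W) : Set B :=
  {b | ∃ ω : List B, cs.IsReduced ω ∧ cs.wordProd ω = w ∧ b ∈ ω}

/-- `w` is saturated in the parabolic subgroup generated by the simple reflections with index in
`J`: it belongs to this subgroup and its support is all of `J`. -/
def SaturatedIn {B W : Type*} [Group W] {M : CoxeterMatrix B} (cs : CoxeterSystem M W) (J : Set B)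
    (w : W) : Prop :=
  w ∈ Subgroup.closure (cs.simple '' J) ∧ support cs w = J

/-- The generator `σ_h` of `W(A_n)`, `1 ≤ h ≤ n` (the value at other `h` is irrelevant). -/
def sigma {n : ℕ} {W : Type*} [Group W] (cs : CoxeterSystem (CoxeterMatrix.A n) W) (h : ℕ) : W :=
  if hh : 1 ≤ h ∧ h ≤ n then cs.simple ⟨h - 1, by omega⟩ else 1

/-- The product in `W(A_n)` of a word in the numbers `1, …, n`. -/
def wordElement {n : ℕ} {W : Type*} [Group W] (cs : CoxeterSystem (CoxeterMatrix.A n) W)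
    (ω : List ℕ) : W :=
  (ω.map (sigma cs)).prod

/-- The indices in `Fin n` of the generators `σ_h` with `a ≤ h ≤ b`. -/
def genRange (n a b : ℕ) : Set (Fin n) := {k | a ≤ (k : ℕ) + 1 ∧ (k : ℕ) + 1 ≤ b}

/-! ### The combinatorial rules -/

/-- The condition on `1 ≤ t < s ≤ p` under which `(i_s, (j_t + 1)')` is to be an arrow: the
equality, the minimality condition and the saturation condition. -/
structure PositiveRule {n : ℕ} {W : Type*} [Group W] (cs : CoxeterSystem (CoxeterMatrix.A n) W)
    (i j : ℕ → ℕ) (t s : ℕ) : Prop where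
  eq : (j t : ℤ) = i s + 2 * ((s : ℤ) - t) - 1
  minimal : ∀ r, t < r → r < s →
    (j r : ℤ) ≠ i s + 2 * ((s : ℤ) - r) - 1 ∧ (j t : ℤ) ≠ i r + 2 * ((r : ℤ) - t) - 1
  saturated : SaturatedIn cs (genRange n (i s + 1) (j t - 1)) (wordElement cs (blocksWord i j (t + 1) s))

/-- The sets `A(r)`, where `P` is the set of positive arrows; `f_k = min A(k)` is `sInf (A(k))`. -/
def setA (i j : ℕ → ℕ) (P : Set Arrow) (r : ℕ) : Set ℕ :=
  if r = 1 then Set.Icc (i 1 + 1) (j 1 + 1)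
  else {x | .top (i r) ∉ tails P ∧ x ∈ Set.Icc (i r + 1) (j 1 + 1) ∧
    (∀ k, 1 ≤ k → k < r → x ≠ i k) ∧
    (∀ k, 1 ≤ k → ∀ _h : k < r, (setA i j P k).Nonempty → x ≠ sInf (setA i j P k))}
termination_by r

/-- The sets `B(r)`, `r ≤ p`, where `P` is the set of positive arrows; `g_k = max B(k)` is
`sSup (B(k))`. -/
def setB (p : ℕ) (i j : ℕ → ℕ) (P : Set Arrow) (r : ℕ) : Set ℕ :=
  if r = p then Set.Icc (i p) (j p)
  else {x | .bot (j r + 1) ∉ heads P ∧ x ∈ Set.Icc (i p) (j r) ∧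
    (∀ k, r < k → k ≤ p → x ≠ j k + 1) ∧
    (∀ k, ∀ _h : r < k ∧ k ≤ p, (setB p i j P k).Nonempty → x ≠ sSup (setB p i j P k))}
termination_by p - r

end FCDiagram

namespace FCDiagram

/-! ### Diagrams as involutions of the dots -/

/-! A diagram is encoded as an involution `m` of the dots. Order all dots from left to right with x'
just before x, so that each string has a left and a right end and every vertical string starts at
its bottom dot. With this tie-break 𝓘 consists of the top dots that are left ends, and 𝓙, shifted by
one, of the bottom dots that are right ends. Concatenation with E_a acts on `m` by `smooth`. In a
block [i_k, j_k] the first letter adds i_k to 𝓘 and to 𝓙; each further letter a replaces a - 1 by a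
in 𝓙. So the canonical word produces exactly the i_k and the j_k (`exists_matching_diagram`). From
there on only these two sets and the absence of crossings matter.

For the positive arrows, give left ends the sign -1 and right ends the sign +1. A set of dots closed
under `m` has sum 0, and a set that strings leave in one direction only has a sum of known sign. The
sums telescope in the potentials x + 2 #{k : i_k > x} in the top row and y + 2 #{k : j_k + 1 > y} in
the bottom row. The dots right of an arrow are closed under `m`, which yields the equality;
intervals beside the arrow yield inequalities, hence minimality and the covering of the interval by
blocks (`rule_of_arrow`, `cover_of_arrow`). Conversely, equality and minimality alone force the
arrow (`arrow_of_rule`), so saturation is a consequence. It follows from the covering by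
`saturatedIn_blocksWord`: the support of a product of blocks is the set of its letters, by strong
exchange for one inclusion and the permutation action for the other.

For the arcs, the dots strictly under an arc from i_r are joined to each other, so each is a left
end or the head of an arc with a larger left end, that is, a smaller index. The head is therefore
the first dot that is not excluded, which is the greedy rule for A(r). The bottom row is the mirror
image. -/

noncomputable instance : DecidableEq Dot := Classical.decEq _

/-- The dots ordered from left to right, the dot `x'` just before the dot `x`. -/
def Dot.key : Dot → ℕ
  | .top x => 2 * x + 1
  | .bot x => 2 * x

theorem Dot.key_injective : Function.Injective Dot.key := by
  rintro (x | x) (y | y) h <;> simp only [Dot.key] at h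
  · exact congrArg _ (by omega)
  · omega
  · omega
  · exact congrArg _ (by omega)

theorem Dot.pos_injOn {n : ℕ} {x y : Dot} (hx : x.IsOn n) (hy : y.IsOn n)
    (h : x.pos n = y.pos n) : x = y := by
  rcases x with x | x <;> rcases y with y | y <;>
    simp only [Dot.IsOn, Dot.num, Dot.pos] at hx hy h
  · exact congrArg _ (by omega)
  · omega
  · omega
  · exact congrArg _ (by omega)

theorem Dot.Lt.ne {x y : Dot} (h : x.Lt y) : x ≠ y := by
  rintro rfl
  rcases x with x | x <;> simp [Dot.Lt] at h

theorem Dot.lt_or_lt {x y : Dot} (h : x ≠ y) : x.Lt y ∨ y.Lt x := by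
  rcases x with x | x <;> rcases y with y | y <;> simp_all [Dot.Lt]

/-- The involution `m` describes a non-crossing diagram on `n + 1` strings. -/
structure IsMatching (n : ℕ) (m : Dot → Dot) : Prop where
  invol : ∀ x, m (m x) = x
  fixed_iff : ∀ x, m x = x ↔ ¬ x.IsOn n
  nested : ∀ c x, c.pos n < x.pos n → x.pos n < (m c).pos n →
    c.pos n < (m x).pos n ∧ (m x).pos n < (m c).pos n

/-- The set of arrows of an involution of the dots. -/
def arrows (m : Dot → Dot) : Set Arrow := {a | a.1.Lt a.2 ∧ m a.1 = a.2}

namespace IsMatching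

variable {n : ℕ} {m : Dot → Dot} (hm : IsMatching n m)
include hm

theorem isOn_of_ne {x : Dot} (h : m x ≠ x) : x.IsOn n := by
  by_contra hx
  exact h ((hm.fixed_iff x).2 hx)

theorem ne_of_isOn {x : Dot} (h : x.IsOn n) : m x ≠ x := fun hx => (hm.fixed_iff x).1 hx h

theorem isOn_apply {x : Dot} (h : x.IsOn n) : (m x).IsOn n :=
  hm.isOn_of_ne fun h' => hm.ne_of_isOn h ((hm.invol x).symm.trans h').symm

theorem injective {x y : Dot} (h : m x = m y) : x = y := by
  rw [← hm.invol x, h, hm.invol]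

theorem joined_iff {x y : Dot} : Joined (arrows m) x y ↔ x ≠ y ∧ m x = y := by
  constructor
  · rintro (⟨h, h'⟩ | ⟨h, h'⟩)
    · exact ⟨h.ne, h'⟩
    · exact ⟨h.ne.symm, by dsimp only at h'; rw [← h', hm.invol]⟩
  · rintro ⟨h, rfl⟩
    rcases Dot.lt_or_lt h with h | h
    · exact Or.inl ⟨h, rfl⟩
    · exact Or.inr ⟨h, hm.invol x⟩

theorem isDiagram : IsDiagram n (arrows m) where
  isOn x y h := by
    obtain ⟨h, h'⟩ := h
    dsimp only at h h'
    subst h'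
    have := hm.isOn_of_ne h.ne.symm
    exact ⟨this, hm.isOn_apply this, h⟩
  matching x hx := by
    refine ⟨m x, hm.joined_iff.2 ⟨(hm.ne_of_isOn hx).symm, rfl⟩, fun y hy => ?_⟩
    exact (hm.joined_iff.1 hy).2.symm
  nonCrossing a b c d hab hcd h := by
    obtain ⟨-, rfl⟩ := hm.joined_iff.1 hab
    obtain ⟨-, rfl⟩ := hm.joined_iff.1 hcd
    have := hm.nested a c h.1 h.2.1
    omega

end IsMatching

/-- The involution of the identity diagram. -/
noncomputable def idMatching (n : ℕ) : Dot → Dot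
  | .top x => if 1 ≤ x ∧ x ≤ n + 1 then .bot x else .top x
  | .bot x => if 1 ≤ x ∧ x ≤ n + 1 then .top x else .bot x

theorem isMatching_idMatching (n : ℕ) : IsMatching n (idMatching n) where
  invol x := by rcases x with x | x <;> simp only [idMatching] <;> split_ifs <;> simp_all
  fixed_iff x := by
    rcases x with x | x <;> simp only [idMatching, Dot.IsOn, Dot.num] <;> split_ifs <;> simp_all
  nested c x := by
    rcases c with c | c <;> rcases x with x | x <;> simp only [idMatching] <;> split_ifs <;>
      simp only [Dot.pos] <;> omega

theorem arrows_idMatching (n : ℕ) : arrows (idMatching n) = idDiagram n := by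
  ext ⟨x, y⟩
  constructor
  · rintro ⟨h, h'⟩
    rcases x with x | x <;> simp only [idMatching] at h' <;> split_ifs at h' with hx <;> subst h'
    · exact ⟨x, hx.1, hx.2, rfl⟩
    · exact absurd rfl h.ne
    · exact absurd h (by simp [Dot.Lt])
    · exact absurd rfl h.ne
  · rintro ⟨k, h1, h2, h⟩
    obtain ⟨rfl, rfl⟩ := Prod.mk.inj h
    exact ⟨trivial, if_pos ⟨h1, h2⟩⟩

/-- The involution of the concatenation of a diagram with `E_a`. -/
noncomputable def smooth (m : Dot → Dot) (a : ℕ) (x : Dot) : Dot :=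
  if x = .bot a then .bot (a + 1)
  else if x = .bot (a + 1) then .bot a
  else if m x = .bot a then m (.bot (a + 1))
  else if m x = .bot (a + 1) then m (.bot a)
  else m x

/-! ### Concatenation with a single generator diagram -/

section smooth

variable {n : ℕ} {m : Dot → Dot} {a : ℕ}

theorem smooth_bot_left : smooth m a (.bot a) = .bot (a + 1) := if_pos rfl

theorem smooth_bot_right : smooth m a (.bot (a + 1)) = .bot a := by
  simp [smooth]

theorem smooth_cases (m : Dot → Dot) (a : ℕ) (x : Dot) :
    (x = .bot a ∧ smooth m a x = .bot (a + 1)) ∨ (x = .bot (a + 1) ∧ smooth m a x = .bot a) ∨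
    (x ≠ .bot a ∧ x ≠ .bot (a + 1) ∧ m x = .bot a ∧ smooth m a x = m (.bot (a + 1))) ∨
    (x ≠ .bot a ∧ x ≠ .bot (a + 1) ∧ m x = .bot (a + 1) ∧ smooth m a x = m (.bot a)) ∨
    (x ≠ .bot a ∧ x ≠ .bot (a + 1) ∧ m x ≠ .bot a ∧ m x ≠ .bot (a + 1) ∧ smooth m a x = m x) := by
  unfold smooth
  split_ifs <;> simp_all

theorem isOn_bot (ha : 1 ≤ a) (han : a ≤ n + 1) : (Dot.bot a).IsOn n := ⟨ha, han⟩

theorem isOn_top (ha : 1 ≤ a) (han : a ≤ n + 1) : (Dot.top a).IsOn n := ⟨ha, han⟩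

theorem IsMatching.smooth_invol (hm : IsMatching n m) (ha : 1 ≤ a) (han : a ≤ n) (x : Dot) :
    smooth m a (smooth m a x) = x := by
  have inv := hm.invol
  have hne : Dot.bot a ≠ Dot.bot (a + 1) := by simp
  have h1 := hm.ne_of_isOn (isOn_bot ha (by omega : a ≤ n + 1))
  have h2 := hm.ne_of_isOn (isOn_bot (by omega) (by omega) : (Dot.bot (a + 1)).IsOn n)
  have := smooth_cases m a x
  have := smooth_cases m a (smooth m a x)
  grind

theorem IsMatching.smooth_fixed_iff (hm : IsMatching n m) (ha : 1 ≤ a) (han : a ≤ n) (x : Dot) :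
    smooth m a x = x ↔ ¬ x.IsOn n := by
  have inv := hm.invol
  have hne : Dot.bot a ≠ Dot.bot (a + 1) := by simp
  have h1 : (Dot.bot a).IsOn n := isOn_bot ha (by omega)
  have h2 : (Dot.bot (a + 1)).IsOn n := isOn_bot (by omega) (by omega)
  have hf := hm.fixed_iff
  have hon := fun x => @IsMatching.isOn_apply n m hm x
  have := smooth_cases m a x
  grind

/-- Nothing lies between the neighbours `A` and `B` on the boundary, so a string with one end
between `m A` and `m B` could leave this interval only by crossing the string of `A` or that of `B`.
-/
theorem IsMatching.between_of_adjacent (hm : IsMatching n m) {A B x : Dot}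
    (hAB : A.pos n = B.pos n + 1 ∨ B.pos n = A.pos n + 1)
    (hAx : (m x).pos n ≠ A.pos n) (hBx : (m x).pos n ≠ B.pos n)
    (hPx : (m x).pos n ≠ (m A).pos n) (hQx : (m x).pos n ≠ (m B).pos n)
    (hA : x.pos n ≠ A.pos n) (hB : x.pos n ≠ B.pos n)
    (h1 : (m A).pos n < x.pos n) (h2 : x.pos n < (m B).pos n) :
    (m A).pos n < (m x).pos n ∧ (m x).pos n < (m B).pos n := by
  have a1 := hm.nested A x
  have a2 := hm.nested B x
  have a3 := hm.nested (m A) x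
  have a4 := hm.nested (m B) x
  have b1 := hm.nested A (m x)
  have b2 := hm.nested B (m x)
  have b3 := hm.nested (m A) (m x)
  have b4 := hm.nested (m B) (m x)
  have c1 := hm.nested A B
  have c2 := hm.nested B A
  have c3 := hm.nested (m A) B
  have c4 := hm.nested (m B) A
  simp only [hm.invol] at *
  omega

theorem IsMatching.smooth_nested (hm : IsMatching n m) (ha : 1 ≤ a) (han : a ≤ n) (c x : Dot)
    (h1 : c.pos n < x.pos n) (h2 : x.pos n < (smooth m a c).pos n) :
    c.pos n < (smooth m a x).pos n ∧ (smooth m a x).pos n < (smooth m a c).pos n := by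
  by_cases hx : x.IsOn n
  swap
  · rw [(hm.smooth_fixed_iff ha han x).2 hx]
    exact ⟨h1, h2⟩
  have hc : c.IsOn n := by
    by_contra hc
    rw [(hm.smooth_fixed_iff ha han c).2 hc] at h2
    omega
  have hA : (Dot.bot a).IsOn n := isOn_bot ha (by omega)
  have hB : (Dot.bot (a + 1)).IsOn n := isOn_bot (by omega) (by omega)
  have hAB : (Dot.bot a).pos n = (Dot.bot (a + 1)).pos n + 1 := by
    simp only [Dot.pos]; push_cast; ring
  have inj : ∀ {x y : Dot}, x.IsOn n → y.IsOn n → x ≠ y → x.pos n ≠ y.pos n :=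
    fun hx hy hne h => hne (Dot.pos_injOn hx hy h)
  have hP := hm.isOn_apply hA
  have hQ := hm.isOn_apply hB
  have hmx := hm.isOn_apply hx
  have hmc := hm.isOn_apply hc
  have eq_of : ∀ {u v : Dot}, m u = v → u = m v := fun h => by rw [← h, hm.invol]
  have inj' : ∀ {u v : Dot}, u ≠ v → m u ≠ m v := fun h h' => h (hm.injective h')
  rcases smooth_cases m a c with ⟨rfl, e⟩ | ⟨rfl, e⟩ | ⟨c1, c2, c3, e⟩ | ⟨c1, c2, c3, e⟩ |
      ⟨c1, c2, c3, c4, e⟩ <;>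
    rw [e] at h2 ⊢
  · omega
  · omega
  · rcases smooth_cases m a x with ⟨rfl, f⟩ | ⟨rfl, f⟩ | ⟨d1, d2, d3, f⟩ | ⟨d1, d2, d3, f⟩ |
        ⟨d1, d2, d3, d4, f⟩ <;>
      rw [f]
    · have := inj hc hB c2
      omega
    · have := inj hQ hA fun h => c2 ((eq_of c3).trans (eq_of h).symm)
      omega
    · rw [eq_of d3, eq_of c3] at h1
      omega
    · rw [eq_of d3] at h2
      omega
    · obtain rfl := eq_of c3
      exact hm.between_of_adjacent (Or.inl hAB) (inj hmx hA d3) (inj hmx hB d4)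
        (inj hmx hP (inj' d1)) (inj hmx hQ (inj' d2)) (inj hx hA d1) (inj hx hB d2) h1 h2
  · rcases smooth_cases m a x with ⟨rfl, f⟩ | ⟨rfl, f⟩ | ⟨d1, d2, d3, f⟩ | ⟨d1, d2, d3, f⟩ |
        ⟨d1, d2, d3, d4, f⟩ <;>
      rw [f]
    · have := inj hc hB c2
      omega
    · have := inj hP hA (hm.ne_of_isOn hA)
      omega
    · rw [eq_of d3] at h2
      omega
    · rw [eq_of d3, eq_of c3] at h1
      omega
    · obtain rfl := eq_of c3
      exact hm.between_of_adjacent (Or.inr hAB) (inj hmx hB d4) (inj hmx hA d3)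
        (inj hmx hQ (inj' d2)) (inj hmx hP (inj' d1)) (inj hx hB d2) (inj hx hA d1) h1 h2
  · have e1 := inj hc hA c1
    have e2 := inj hc hB c2
    have e3 := inj hmc hA c3
    have e4 := inj hmc hB c4
    rcases smooth_cases m a x with ⟨rfl, f⟩ | ⟨rfl, f⟩ | ⟨d1, d2, d3, f⟩ | ⟨d1, d2, d3, f⟩ |
        ⟨d1, d2, d3, d4, f⟩ <;>
      rw [f]
    · omega
    · omega
    · have := hm.nested c x h1 h2
      rw [d3] at this
      exact hm.nested c _ (by omega) (by omega)
    · have := hm.nested c x h1 h2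
      rw [d3] at this
      exact hm.nested c _ (by omega) (by omega)
    · exact hm.nested c x h1 h2

theorem IsMatching.smooth (hm : IsMatching n m) (ha : 1 ≤ a) (han : a ≤ n) :
    IsMatching n (smooth m a) where
  invol := hm.smooth_invol ha han
  fixed_iff := hm.smooth_fixed_iff ha han
  nested := hm.smooth_nested ha han

/-- The two ends of the string of `D ∗ E_a` on which a dot of the stack lies. -/
noncomputable def stackLabel (m : Dot → Dot) (a : ℕ) (u : StackDot) : Sym2 Dot :=
  if u.1 = 0 then s(.top u.2, FCDiagram.smooth m a (.top u.2))
  else if u.1 = 2 then s(.bot u.2, FCDiagram.smooth m a (.bot u.2))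
  else if u.2 = a ∨ u.2 = a + 1 then s(m (.bot a), m (.bot (a + 1)))
  else s(.bot u.2, FCDiagram.smooth m a (.bot u.2))

theorem stackLabel_outer (x : Dot) : stackLabel m a x.outer = s(x, FCDiagram.smooth m a x) := by
  rcases x with x | x <;> simp [stackLabel, Dot.outer]

theorem IsMatching.stackLabel_upper (hm : IsMatching n m) (ha : 1 ≤ a) (han : a ≤ n) (x : Dot) :
    stackLabel m a x.upper = stackLabel m a (m x).upper := by
  have inv := hm.invol
  have key : ∀ x : Dot, stackLabel m a x.upper =
      if x = .bot a ∨ x = .bot (a + 1) then s(m (.bot a), m (.bot (a + 1)))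
      else s(x, FCDiagram.smooth m a x) := by
    rintro (x | x)
    · simp [stackLabel, Dot.upper]
    · by_cases h : x = a ∨ x = a + 1 <;> simp [stackLabel, Dot.upper, h]
  have h1 := hm.ne_of_isOn (isOn_bot ha (by omega : a ≤ n + 1))
  have h2 := hm.ne_of_isOn (isOn_bot (by omega) (by omega) : (Dot.bot (a + 1)).IsOn n)
  rw [key, key]
  have := smooth_cases m a x
  have := smooth_cases m a (m x)
  have hs : ∀ x y : Dot, s(x, y) = s(y, x) := fun x y => Sym2.eq_swap
  grind

/-- This makes the label an invariant of the connected components of the stack. If `m` joins the two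
middle dots, their circle shares its label with the new bottom cap; this is harmless, because only
labels of outer dots get compared. -/
theorem stackLabel_eq_of_stackStep (hm : IsMatching n m) (ha : 1 ≤ a) (han : a ≤ n)
    {u v : StackDot} (h : StackStep (arrows m) (E n a) u v) :
    stackLabel m a u = stackLabel m a v := by
  rcases h with ⟨⟨x, y⟩, ⟨-, h⟩, rfl, rfl⟩ | ⟨⟨x, y⟩, h, rfl, rfl⟩
  · dsimp only at h ⊢
    rw [← h]
    exact hm.stackLabel_upper ha han x
  · rcases h with (h | h) | ⟨k, hk, h⟩ <;> obtain ⟨rfl, rfl⟩ := Prod.mk.inj h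
    · simp [stackLabel, Dot.lower]
    · simp [stackLabel, Dot.lower, smooth_bot_left, smooth_bot_right, Sym2.eq_swap]
    · have : k ≠ a ∧ k ≠ a + 1 := by omega
      simp [stackLabel, Dot.lower, this]

/-- One inclusion follows from the invariance of the labels. For the other the path is explicit: it
passes through the middle row and uses the top arc of `E n a` at most once. -/
theorem concat_arrows (hm : IsMatching n m) (ha : 1 ≤ a) (han : a ≤ n) :
    concat (arrows m) (E n a) = arrows (FCDiagram.smooth m a) := by
  ext ⟨x, y⟩
  refine and_congr_right fun hxy => ?_
  dsimp only at hxy ⊢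
  constructor
  · intro h
    have h' : stackLabel m a x.outer = stackLabel m a y.outer := by
      clear hxy
      generalize x.outer = u at h
      generalize y.outer = v at h
      induction h with
      | rel u v h => exact stackLabel_eq_of_stackStep hm ha han h
      | refl u => rfl
      | symm u v _ ih => exact ih.symm
      | trans u v w _ _ ih ih' => exact ih.trans ih'
    rw [stackLabel_outer, stackLabel_outer, Sym2.eq_iff] at h'
    rcases h' with ⟨h', -⟩ | ⟨-, h'⟩
    · exact absurd h' hxy.ne
    · exact h'
  · rintro rfl
    have up : ∀ x : Dot, Relation.EqvGen (StackStep (arrows m) (E n a)) x.upper (m x).upper := by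
      intro x
      by_cases h : x = m x
      · rw [← h]; exact .refl _
      rcases Dot.lt_or_lt h with h | h
      · exact .rel _ _ (Or.inl ⟨(x, m x), ⟨h, rfl⟩, rfl, rfl⟩)
      · exact .symm _ _ (.rel _ _ (Or.inl ⟨(m x, x), ⟨h, hm.invol x⟩, rfl, rfl⟩))
    have thr : ∀ x : Dot, x.IsOn n → x ≠ .bot a → x ≠ .bot (a + 1) →
        Relation.EqvGen (StackStep (arrows m) (E n a)) x.outer x.upper := by
      rintro (x | x) hx h1 h2
      · exact .refl _
      · refine .symm _ _ (.rel _ _ (Or.inr ⟨(.top x, .bot x), Or.inr ⟨x, ?_, rfl⟩, rfl, rfl⟩))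
        have h1 : x ≠ a := fun h => h1 (congrArg _ h)
        have h2 : x ≠ a + 1 := fun h => h2 (congrArg _ h)
        have := hx.1
        have := hx.2
        simp only [Dot.num] at *
        omega
    have mid : Relation.EqvGen (StackStep (arrows m) (E n a)) (Dot.bot a).upper
        (Dot.bot (a + 1)).upper :=
      .rel _ _ (Or.inr ⟨(.top a, .top (a + 1)), Or.inl (Or.inl rfl), rfl, rfl⟩)
    have cap : Relation.EqvGen (StackStep (arrows m) (E n a)) (Dot.bot a).outer
        (Dot.bot (a + 1)).outer :=
      .rel _ _ (Or.inr ⟨(.bot a, .bot (a + 1)), Or.inl (Or.inr rfl), rfl, rfl⟩)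
    have hx : x.IsOn n := (hm.smooth ha han).isOn_of_ne hxy.ne.symm
    have hA : (Dot.bot a).IsOn n := isOn_bot ha (by omega)
    have hB : (Dot.bot (a + 1)).IsOn n := isOn_bot (by omega) (by omega)
    rcases smooth_cases m a x with ⟨rfl, e⟩ | ⟨rfl, e⟩ | ⟨c1, c2, c3, e⟩ | ⟨c1, c2, c3, e⟩ |
        ⟨c1, c2, c3, c4, e⟩ <;>
      rw [e]
    · exact cap
    · exact .symm _ _ cap
    · have h1 : m (.bot (a + 1)) ≠ .bot a := fun h =>
        c2 (by rw [← hm.invol x, c3, ← h, hm.invol])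
      refine .trans _ _ _ (thr x hx c1 c2) (.trans _ _ _ (up x) ?_)
      rw [c3]
      exact .trans _ _ _ mid (.trans _ _ _ (up _)
        (.symm _ _ (thr _ (hm.isOn_apply hB) h1 (hm.ne_of_isOn hB))))
    · have h1 : m (.bot a) ≠ .bot (a + 1) := fun h =>
        c1 (by rw [← hm.invol x, c3, ← h, hm.invol])
      refine .trans _ _ _ (thr x hx c1 c2) (.trans _ _ _ (up x) ?_)
      rw [c3]
      exact .trans _ _ _ (.symm _ _ mid) (.trans _ _ _ (up _)
        (.symm _ _ (thr _ (hm.isOn_apply hA) (hm.ne_of_isOn hA) h1)))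
    · exact .trans _ _ _ (thr x hx c1 c2) (.trans _ _ _ (up x)
        (.symm _ _ (thr _ (hm.isOn_apply hx) c3 c4)))

end smooth

/-! ### Left and right ends of the strings -/

/-- The top dots that are the left end of their string are those in `I`, and the bottom dots that
are the right end of their string are the `(y + 1)'` with `y ∈ J`. -/
structure Oriented (m : Dot → Dot) (I J : Set ℕ) : Prop where
  top_iff : ∀ x, (Dot.top x).key < (m (.top x)).key ↔ x ∈ I
  bot_iff : ∀ x, (m (.bot x)).key < (Dot.bot x).key ↔ ∃ y ∈ J, x = y + 1

section Orientation

variable {n : ℕ} {m : Dot → Dot} {I J : Set ℕ} {a : ℕ}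

theorem IsMatching.key_lt_or_lt (hm : IsMatching n m) {x : Dot} (hx : x.IsOn n) :
    x.key < (m x).key ∨ (m x).key < x.key := by
  have : x.key ≠ (m x).key := fun h => hm.ne_of_isOn hx (Dot.key_injective h).symm
  omega

theorem oriented_idMatching : Oriented (idMatching n) ∅ ∅ where
  top_iff x := by
    simp only [idMatching, Set.mem_empty_iff_false, iff_false]
    split_ifs <;> simp [Dot.key]
  bot_iff x := by
    simp only [idMatching, Set.mem_empty_iff_false, false_and, exists_false, iff_false]
    split_ifs <;> simp [Dot.key]

/-- Left of all elements of `I` the strings are vertical. -/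
theorem Oriented.apply_top_of_lt (hm : IsMatching n m) (ho : Oriented m I J)
    {b : ℕ} (hI : ∀ x ∈ I, b < x) {x : ℕ} (hx : 1 ≤ x) (hxb : x ≤ b) (hxn : x ≤ n + 1) :
    m (.top x) = .bot x := by
  induction x using Nat.strong_induction_on with
  | _ x ih =>
    have h1 : ¬ (Dot.top x).key < (m (.top x)).key := fun h => by
      have := hI x ((ho.top_iff x).1 h)
      omega
    have h2 := hm.key_lt_or_lt (isOn_top hx hxn)
    have hon := hm.isOn_apply (isOn_top hx hxn)
    rcases h : m (.top x) with y | y <;> rw [h] at h1 h2 hon <;>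
      simp only [Dot.key, Dot.IsOn, Dot.num] at h1 h2 hon
    · have h3 : m (.top y) = .top x := by rw [← h, hm.invol]
      have h4 := ih y (by omega) hon.1 (by omega) (by omega)
      rw [h3] at h4
      cases h4
    · by_cases hyx : y = x
      · rw [hyx]
      · have h4 := ih y (by omega) hon.1 (by omega) (by omega)
        have h5 := hm.injective (h4.trans (h.symm))
        exact absurd (Dot.top.inj h5) hyx

/-- Right of all elements of `J` the strings are vertical. -/
theorem Oriented.apply_bot_of_gt (hm : IsMatching n m) (ho : Oriented m I J)
    {b : ℕ} (hJ : ∀ y ∈ J, y + 1 < b) {x : ℕ} (hx : 1 ≤ x) (hbx : b ≤ x) (hxn : x ≤ n + 1) :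
    m (.bot x) = .top x := by
  induction hk : n + 1 - x using Nat.strong_induction_on generalizing x with
  | _ k ih =>
    have h1 : ¬ (m (.bot x)).key < (Dot.bot x).key := fun h => by
      obtain ⟨y, hy, rfl⟩ := (ho.bot_iff x).1 h
      have := hJ y hy
      omega
    have h2 := hm.key_lt_or_lt (isOn_bot hx hxn)
    have hon := hm.isOn_apply (isOn_bot hx hxn)
    rcases h : m (.bot x) with y | y <;> rw [h] at h1 h2 hon <;>
      simp only [Dot.key, Dot.IsOn, Dot.num] at h1 h2 hon
    · by_cases hyx : y = x
      · rw [hyx]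
      · have h4 := ih (n + 1 - y) (by omega) hon.1 (by omega) (by omega) rfl
        have h5 := hm.injective (h4.trans (h.symm))
        exact absurd (Dot.bot.inj h5) hyx
    · have h3 : m (.bot y) = .bot x := by rw [← h, hm.invol]
      have h4 := ih (n + 1 - y) (by omega) hon.1 (by omega) (by omega) rfl
      rw [h3] at h4
      cases h4

/-- The dot `a'` is a right end and `(a + 1)'` a left end, so their partners lie to the left and to
the right respectively. Splicing the two strings keeps the roles of these partners; only the new cap
changes `J`. -/
theorem Oriented.smooth_extend (hm : IsMatching n m) (ho : Oriented m I J) (ha : 1 ≤ a)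
    (han : a ≤ n) (h1 : a - 1 ∈ J) (h2 : a ∉ J) :
    Oriented (smooth m a) I ((J \ {a - 1}) ∪ {a}) := by
  have hA : (m (.bot a)).key < (Dot.bot a).key := (ho.bot_iff a).2 ⟨a - 1, h1, by omega⟩
  have hB : (Dot.bot (a + 1)).key < (m (.bot (a + 1))).key := by
    rcases hm.key_lt_or_lt (isOn_bot (by omega) (by omega) : (Dot.bot (a + 1)).IsOn n) with h | h
    · exact h
    · obtain ⟨y, hy, h⟩ := (ho.bot_iff _).1 h
      exact absurd (by rwa [show a = y by omega]) h2
  have eq_of : ∀ {u v : Dot}, m u = v → u = m v := fun h => by rw [← h, hm.invol]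
  constructor
  · intro x
    rw [← ho.top_iff]
    rcases smooth_cases m a (.top x) with ⟨e, -⟩ | ⟨e, -⟩ | ⟨-, -, c, e⟩ | ⟨-, -, c, e⟩ |
      ⟨-, -, -, -, e⟩
    · cases e
    · cases e
    · rw [e, c]
      rw [eq_of c]
      simp only [Dot.key] at *
      omega
    · rw [e, c]
      rw [eq_of c]
      simp only [Dot.key] at *
      omega
    · rw [e]
  · intro x
    have hJ : (∃ y ∈ (J \ {a - 1}) ∪ {a}, x = y + 1) ↔
        (x = a + 1 ∨ (x ≠ a ∧ ∃ y ∈ J, x = y + 1)) := by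
      constructor
      · rintro ⟨y, ⟨hy, hy'⟩ | rfl, rfl⟩
        · refine Or.inr ⟨fun h => hy' ?_, y, hy, rfl⟩
          simp only [Set.mem_singleton_iff]
          omega
        · exact Or.inl rfl
      · rintro (rfl | ⟨h, y, hy, rfl⟩)
        · exact ⟨a, Or.inr rfl, rfl⟩
        · refine ⟨y, Or.inl ⟨hy, fun h' => h ?_⟩, rfl⟩
          simp only [Set.mem_singleton_iff] at h'
          omega
    rw [hJ, ← ho.bot_iff]
    rcases smooth_cases m a (.bot x) with ⟨e', e⟩ | ⟨e', e⟩ | ⟨c1, c2, c, e⟩ | ⟨c1, c2, c, e⟩ |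
      ⟨c1, c2, -, -, e⟩
    · obtain rfl := Dot.bot.inj e'
      rw [e]
      simp [Dot.key]
    · obtain rfl := Dot.bot.inj e'
      rw [e]
      simp [Dot.key]
    · have c1 : x ≠ a := fun h => c1 (congrArg _ h)
      have c2 : x ≠ a + 1 := fun h => c2 (congrArg _ h)
      rw [e, c]
      rw [eq_of c]
      simp only [Dot.key] at *
      omega
    · have c1 : x ≠ a := fun h => c1 (congrArg _ h)
      have c2 : x ≠ a + 1 := fun h => c2 (congrArg _ h)
      rw [e, c]
      rw [eq_of c]
      simp only [Dot.key] at *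
      omega
    · have c1 : x ≠ a := fun h => c1 (congrArg _ h)
      have c2 : x ≠ a + 1 := fun h => c2 (congrArg _ h)
      rw [e]
      simp [c1, c2]

/-- The string at the top dot `a` is still vertical and `(a + 1)'` is a left end. After splicing,
the top dot `a` has a partner further right and turns from a right end into a left end. -/
theorem Oriented.smooth_start (hm : IsMatching n m) (ho : Oriented m I J) (ha : 1 ≤ a)
    (han : a ≤ n) (hI : ∀ x ∈ I, a < x) (hJ : ∀ y ∈ J, a < y) :
    Oriented (smooth m a) (I ∪ {a}) (J ∪ {a}) := by
  have hA : m (.top a) = .bot a := ho.apply_top_of_lt hm hI ha le_rfl (by omega)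
  have hA' : m (.bot a) = .top a := by rw [← hA, hm.invol]
  have hB : (Dot.bot (a + 1)).key < (m (.bot (a + 1))).key := by
    rcases hm.key_lt_or_lt (isOn_bot (by omega) (by omega) : (Dot.bot (a + 1)).IsOn n) with h | h
    · exact h
    · obtain ⟨y, hy, h⟩ := (ho.bot_iff _).1 h
      have := hJ y hy
      omega
  have eq_of : ∀ {u v : Dot}, m u = v → u = m v := fun h => by rw [← h, hm.invol]
  constructor
  · intro x
    rw [Set.mem_union, ← ho.top_iff, Set.mem_singleton_iff]
    rcases smooth_cases m a (.top x) with ⟨e, -⟩ | ⟨e, -⟩ | ⟨-, -, c, e⟩ | ⟨-, -, c, e⟩ |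
      ⟨-, -, c, -, e⟩
    · cases e
    · cases e
    · have := eq_of c
      rw [hA'] at this
      obtain rfl := Dot.top.inj this
      rw [e]
      refine iff_of_true ?_ (Or.inr rfl)
      simp only [Dot.key] at hB ⊢
      omega
    · have c' := eq_of c
      rw [e, c, hA']
      rw [← c'] at hB
      simp only [Dot.key] at *
      omega
    · have : x ≠ a := by
        rintro rfl
        exact c hA
      rw [e]
      simp [this]
  · intro x
    have hJ' : (∃ y ∈ J ∪ {a}, x = y + 1) ↔ (x = a + 1 ∨ ∃ y ∈ J, x = y + 1) := by
      constructor
      · rintro ⟨y, hy | rfl, rfl⟩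
        · exact Or.inr ⟨y, hy, rfl⟩
        · exact Or.inl rfl
      · rintro (rfl | ⟨y, hy, rfl⟩)
        · exact ⟨a, Or.inr rfl, rfl⟩
        · exact ⟨y, Or.inl hy, rfl⟩
    rw [hJ', ← ho.bot_iff]
    rcases smooth_cases m a (.bot x) with ⟨e', e⟩ | ⟨e', e⟩ | ⟨c1, c2, c, e⟩ | ⟨c1, c2, c, e⟩ |
      ⟨c1, c2, -, -, e⟩
    · obtain rfl := Dot.bot.inj e'
      rw [e, hA']
      simp [Dot.key]
    · obtain rfl := Dot.bot.inj e'
      rw [e]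
      simp [Dot.key]
    · have := eq_of c
      rw [hA'] at this
      cases this
    · have c1 : x ≠ a := fun h => c1 (congrArg _ h)
      have c2 : x ≠ a + 1 := fun h => c2 (congrArg _ h)
      have c' := eq_of c
      rw [e, c, hA']
      rw [← c'] at hB
      simp only [Dot.key] at *
      omega
    · have c2 : x ≠ a + 1 := fun h => c2 (congrArg _ h)
      rw [e]
      simp [c2]

/-! ### The matching of a canonical word -/

/-- The set of the values at `1, …, p` of a sequence. -/
def valueSet (p : ℕ) (i : ℕ → ℕ) : Set ℕ := {x | ∃ k, 1 ≤ k ∧ k ≤ p ∧ x = i k}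

theorem valueSet_succ (p : ℕ) (i : ℕ → ℕ) : valueSet (p + 1) i = valueSet p i ∪ {i (p + 1)} := by
  ext x
  constructor
  · rintro ⟨k, h1, h2, rfl⟩
    rcases Nat.lt_or_ge p k with h | h
    · rw [show k = p + 1 by omega]
      exact Or.inr rfl
    · exact Or.inl ⟨k, h1, h, rfl⟩
  · rintro (⟨k, h1, h2, rfl⟩ | rfl)
    · exact ⟨k, h1, by omega, rfl⟩
    · exact ⟨p + 1, by omega, le_rfl, rfl⟩

theorem wordDiagram_concat (n : ℕ) (ω : List ℕ) (a : ℕ) :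
    wordDiagram n (ω ++ [a]) = concat (wordDiagram n ω) (E n a) := by
  simp [wordDiagram]

theorem IsStandardPair.pred {p : ℕ} {i j : ℕ → ℕ} (h : IsStandardPair n (p + 1) i j) :
    IsStandardPair n p i j where
  size_le := by have := h.size_le; omega
  bounds t h1 h2 := h.bounds t h1 (by omega)
  decr_i s t h1 h2 h3 := h.decr_i s t h1 h2 (by omega)
  decr_j s t h1 h2 h3 := h.decr_j s t h1 h2 (by omega)

/-- The first letter of the block adds `a` to both sets, and each later letter moves the new element
of `J` one step to the right. The bound in `hJ` keeps it from running into the older elements. -/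
theorem exists_matching_append (ω : List ℕ) (hm : IsMatching n m) (ho : Oriented m I J)
    (hω : wordDiagram n ω = arrows m) (ha : 1 ≤ a) (hI : ∀ x ∈ I, a < x) (d : ℕ)
    (hJ : ∀ y ∈ J, a + d < y) (hd : a + d ≤ n) :
    ∃ m', IsMatching n m' ∧ Oriented m' (I ∪ {a}) (J ∪ {a + d}) ∧
      wordDiagram n (ω ++ List.Ico a (a + d + 1)) = arrows m' := by
  induction d with
  | zero =>
    refine ⟨smooth m a, hm.smooth ha (by omega), ho.smooth_start hm ha (by omega) hI hJ, ?_⟩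
    rw [Nat.add_zero, List.Ico.succ_singleton, wordDiagram_concat, hω,
      concat_arrows hm ha (by omega)]
  | succ d ih =>
    obtain ⟨m', hm', ho', hω'⟩ := ih (fun y hy => by have := hJ y hy; omega) (by omega)
    refine ⟨smooth m' (a + d + 1), hm'.smooth (by omega) (by omega), ?_, ?_⟩
    · have := ho'.smooth_extend (a := a + d + 1) hm' (by omega) (by omega) (Or.inr (by simp)) (by
        rintro (h | h)
        · have := hJ _ h
          omega
        · simp only [Set.mem_singleton_iff] at h
          omega)
      convert this using 1
      ext x
      simp only [Set.mem_union, Set.mem_sdiff, Set.mem_singleton_iff]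
      constructor
      · rintro (h | h)
        · have := hJ x h
          exact Or.inl ⟨Or.inl h, by omega⟩
        · exact Or.inr (by omega)
      · rintro (⟨h | h, h'⟩ | h)
        · exact Or.inl h
        · omega
        · exact Or.inr (by omega)
    · rw [show a + (d + 1) + 1 = (a + d + 1) + 1 by omega, List.Ico.succ_top (by omega),
        ← List.append_assoc, wordDiagram_concat, hω', concat_arrows hm' (by omega) (by omega)]

theorem blocksWord_succ (i j : ℕ → ℕ) {a b : ℕ} (h : a ≤ b) :
    blocksWord i j a (b + 1) = blocksWord i j a b ++ List.Ico (i b) (j b + 1) := by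
  simp [blocksWord, List.Ico.succ_top h]

theorem exists_matching_diagram {p : ℕ} {i j : ℕ → ℕ} (h : IsStandardPair n p i j) :
    ∃ m, IsMatching n m ∧ Oriented m (valueSet p i) (valueSet p j) ∧
      diagram n p i j = arrows m := by
  induction p with
  | zero =>
    refine ⟨idMatching n, isMatching_idMatching n, ?_, ?_⟩
    · have : ∀ i : ℕ → ℕ, valueSet 0 i = ∅ := fun i => by
        ext x
        simp only [valueSet, Set.mem_ofPred_eq, Set.mem_empty_iff_false, iff_false]
        rintro ⟨k, h1, h2, -⟩
        omega
      rw [this, this]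
      exact oriented_idMatching
    · rw [arrows_idMatching]
      simp [diagram, wordDiagram, blocksWord]
  | succ p ih =>
    obtain ⟨m, hm, ho, hD⟩ := ih h.pred
    have hb := h.bounds (p + 1) (by omega) le_rfl
    obtain ⟨m', hm', ho', hD'⟩ := exists_matching_append (a := i (p + 1)) _ hm ho hD hb.1
      (by
        rintro x ⟨k, h1, h2, rfl⟩
        exact h.decr_i k (p + 1) h1 (by omega) le_rfl)
      (j (p + 1) - i (p + 1))
      (by
        rintro x ⟨k, h1, h2, rfl⟩
        have := h.decr_j k (p + 1) h1 (by omega) le_rfl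
        omega)
      (by omega)
    rw [show i (p + 1) + (j (p + 1) - i (p + 1)) = j (p + 1) by omega] at ho' hD'
    refine ⟨m', hm', ?_, ?_⟩
    · rwa [valueSet_succ, valueSet_succ]
    · rw [diagram, blocksWord_succ _ _ (by omega), hD']

end Orientation

/-! ### Strong exchange and parabolic subgroups in type `A` -/

section Coxeter

variable {n : ℕ} {W : Type*} [Group W] (cs : CoxeterSystem (CoxeterMatrix.A n) W)

/-- The indicator of a proposition modulo `2`. -/
noncomputable def indicatorModTwo (P : Prop) : ZMod 2 := open Classical in if P then 1 else 0

/-- The action of a simple reflection on `W × ℤ/2`, which counts right inversions modulo `2`. -/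
noncomputable def invStep (s : W) (x : W × ZMod 2) : W × ZMod 2 :=
  (s * x.1 * s, x.2 + indicatorModTwo (x.1 = s))

theorem invStep_invStep {s : W} (hs : s * s = 1) (x : W × ZMod 2) : invStep s (invStep s x) = x := by
  have h1 : s * (s * x.1 * s) * s = x.1 := by
    rw [show s * (s * x.1 * s) * s = (s * s) * x.1 * (s * s) by group, hs]; simp
  have h2 : s * x.1 * s = s ↔ x.1 = s := by
    constructor
    · intro h
      rw [← h1, h, hs, one_mul]
    · intro h
      rw [h, hs, one_mul]
  refine Prod.ext h1 ?_
  simp only [invStep, h2]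
  rw [add_assoc, CharTwo.add_self_eq_zero, add_zero]

theorem invStep_comm {s r : W} (hs : s * s = 1) (hr : r * r = 1) (h : s * r = r * s)
    (x : W × ZMod 2) : invStep s (invStep r x) = invStep r (invStep s x) := by
  have h1 : r * x.1 * r = s ↔ x.1 = s := by
    constructor
    · intro h'
      have : x.1 = r * (r * x.1 * r) * r := by
        rw [show r * (r * x.1 * r) * r = (r * r) * x.1 * (r * r) by group, hr]; simp
      rw [this, h', ← h, mul_assoc, hr, mul_one]
    · intro h'
      rw [h', ← h, mul_assoc, hr, mul_one]
  have h2 : s * x.1 * s = r ↔ x.1 = r := by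
    constructor
    · intro h'
      have : x.1 = s * (s * x.1 * s) * s := by
        rw [show s * (s * x.1 * s) * s = (s * s) * x.1 * (s * s) by group, hs]; simp
      rw [this, h', h, mul_assoc, hs, mul_one]
    · intro h'
      rw [h', h, mul_assoc, hs, mul_one]
  refine Prod.ext ?_ ?_
  · simp only [invStep]
    rw [show s * (r * x.1 * r) * s = (s * r) * x.1 * (r * s) by group,
      show r * (s * x.1 * s) * r = (r * s) * x.1 * (s * r) by group, h]
  · simp only [invStep, h1, h2]
    ring

theorem invStep_braid {s r : W} (hs : s * s = 1) (hr : r * r = 1) (h : s * r * s = r * s * r)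
    (x : W × ZMod 2) :
    invStep s (invStep r (invStep s x)) = invStep r (invStep s (invStep r x)) := by
  have conj : ∀ {a b u : W}, a * a = 1 → (a * u * a = b ↔ u = a * b * a) := by
    intro a b u ha
    constructor
    · rintro rfl
      rw [show a * (a * u * a) * a = (a * a) * u * (a * a) by group, ha]; simp
    · rintro rfl
      rw [show a * (a * b * a) * a = (a * a) * b * (a * a) by group, ha]; simp
  have h1 : s * (r * s * r) * s = r := by
    rw [← h, show s * (s * r * s) * s = (s * s) * r * (s * s) by group, hs]; simp
  have h2 : r * (r * s * r) * r = s := by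
    rw [show r * (r * s * r) * r = (r * r) * s * (r * r) by group, hr]; simp
  refine Prod.ext ?_ ?_
  · simp only [invStep]
    rw [show s * (r * (s * x.1 * s) * r) * s = (s * r * s) * x.1 * (s * r * s) by group,
      show r * (s * (r * x.1 * r) * s) * r = (r * s * r) * x.1 * (r * s * r) by group, h]
  · simp only [invStep, conj hs, conj hr, h1, h2, h]
    ring

/-- The action of a simple reflection on `W × ℤ/2` as a permutation. -/
noncomputable def invPerm (b : Fin n) : Equiv.Perm (W × ZMod 2) :=
  Function.Involutive.toPerm (invStep (cs.simple b)) (invStep_invStep (cs.simple_mul_simple_self b))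

/-- The orders in type `A` are 1, 2 and 3, so the relations reduce to the involution, commutation
and braid identities for `invStep`. -/
theorem isLiftable_invPerm : (CoxeterMatrix.A n).IsLiftable (invPerm cs) := by
  have hs : ∀ b, cs.simple b * cs.simple b = 1 := cs.simple_mul_simple_self
  intro b c
  have hrel := cs.simple_mul_simple_pow b c
  have e : (CoxeterMatrix.A n) b c =
    if b = c then 1 else (if (c : ℕ) + 1 = b ∨ (b : ℕ) + 1 = c then 3 else 2) := rfl
  rw [e] at hrel ⊢
  refine Equiv.ext fun x => ?_
  split_ifs at hrel ⊢ with h1 h2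
  · subst h1
    rw [pow_one]
    exact invStep_invStep (hs b) x
  · set s := cs.simple b
    set r := cs.simple c
    have hbraid : s * r * s = r * s * r := by
      have : (s * r * s) * (r * s * r) = 1 := by
        rw [← hrel]; simp only [pow_succ, pow_zero, one_mul, mul_assoc]
      have h3 : (r * s * r) * (r * s * r) = 1 := by
        rw [show (r * s * r) * (r * s * r) = r * (s * (r * r) * s) * r by group, hs c]
        rw [mul_one, hs b, mul_one, hs c]
      exact mul_right_cancel (this.trans h3.symm)
    change invStep s (invStep r (invStep s (invStep r (invStep s (invStep r x))))) = x
    rw [invStep_braid (hs b) (hs c) hbraid, invStep_invStep (hs c), invStep_invStep (hs b),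
      invStep_invStep (hs c)]
  · set s := cs.simple b
    set r := cs.simple c
    have hcomm : s * r = r * s := by
      have : (s * r) * (s * r) = 1 := by rw [← hrel, pow_two]
      have h3 : (r * s) * (s * r) = 1 := by
        rw [show (r * s) * (s * r) = r * (s * s) * r by group, hs b, mul_one, hs c]
      exact mul_right_cancel (this.trans h3.symm)
    change invStep s (invStep r (invStep s (invStep r x))) = x
    rw [invStep_comm (hs b) (hs c) hcomm, invStep_invStep (hs b), invStep_invStep (hs c)]

/-- The action of `W` on `W × ℤ/2`. -/
noncomputable def invAction : W →* Equiv.Perm (W × ZMod 2) :=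
  cs.lift ⟨_, isLiftable_invPerm cs⟩

/-- The left side depends on the group element only, so the parity of the number of occurrences of
`t` among the right inversions does not depend on the word. Strong exchange rests on this. -/
theorem invAction_wordProd (ω : List (Fin n)) (t : W) :
    open Classical in
    invAction cs (cs.wordProd ω) (t, 0) =
      (cs.wordProd ω * t * (cs.wordProd ω)⁻¹, ((cs.rightInvSeq ω).count t : ZMod 2)) := by
  classical
  induction ω with
  | nil => simp
  | cons b ω ih =>
    rw [cs.wordProd_cons, map_mul, Equiv.Perm.mul_apply, ih, invAction,
      cs.lift_apply_simple]
    have h : (cs.wordProd ω * t * (cs.wordProd ω)⁻¹ = cs.simple b) ↔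
        (cs.wordProd ω)⁻¹ * cs.simple b * cs.wordProd ω = t := by
      constructor
      · intro h; rw [← h]; group
      · intro h; rw [← h]; group
    refine Prod.ext ?_ ?_
    · change cs.simple b * (cs.wordProd ω * t * (cs.wordProd ω)⁻¹) * cs.simple b = _
      simp only [mul_inv_rev, cs.inv_simple]
      group
    · change ((cs.rightInvSeq ω).count t : ZMod 2) + indicatorModTwo _ = _
      simp only [CoxeterSystem.rightInvSeq, List.count_cons, h, beq_iff_eq, indicatorModTwo]
      split_ifs <;> simp

/-- The right inversions of a reduced word occur in every word of the same element. -/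
theorem mem_rightInvSeq_of_wordProd_eq {ω ω' : List (Fin n)} (hω : cs.IsReduced ω)
    (h : cs.wordProd ω = cs.wordProd ω') {t : W} (ht : t ∈ cs.rightInvSeq ω) :
    t ∈ cs.rightInvSeq ω' := by
  classical
  have h1 := invAction_wordProd cs ω t
  have h1' := invAction_wordProd cs ω' t
  rw [← h] at h1'
  have h2 := congrArg Prod.snd (h1.symm.trans h1')
  dsimp only at h2
  by_contra h3
  -- The right inversions of a reduced word are distinct, so the two parities would be 1 and 0.
  rw [List.count_eq_one_of_mem hω.nodup_rightInvSeq ht, List.count_eq_zero_of_not_mem h3] at h2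
  simp at h2

theorem isLiftable_swap :
    (CoxeterMatrix.A n).IsLiftable
      (fun b : Fin n => Equiv.swap ((b : ℕ) + 1) ((b : ℕ) + 2)) := by
  intro b c
  have e : (CoxeterMatrix.A n) b c =
    if b = c then 1 else (if (c : ℕ) + 1 = b ∨ (b : ℕ) + 1 = c then 3 else 2) := rfl
  rw [e]
  split_ifs with h1 h2
  · subst h1
    simp
  · have key : ∀ a : ℕ, Equiv.swap (a + 1) (a + 2) * Equiv.swap (a + 2) (a + 3) *
        Equiv.swap (a + 1) (a + 2) =
        Equiv.swap (a + 2) (a + 3) * Equiv.swap (a + 1) (a + 2) * Equiv.swap (a + 2) (a + 3) := by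
      intro a
      rw [Equiv.swap_mul_swap_mul_swap (by omega) (by omega), Equiv.swap_comm (a + 1) (a + 2),
        Equiv.swap_comm (a + 2) (a + 3), Equiv.swap_mul_swap_mul_swap (by omega) (by omega),
        Equiv.swap_comm]
    have key' : ∀ f g : Equiv.Perm ℕ, f * f = 1 → g * g = 1 → f * g * f = g * f * g →
        (f * g) ^ 3 = 1 := by
      intro f g hf hg h
      rw [show (f * g) ^ 3 = f * g * f * (g * f * g) by
        simp only [pow_succ, pow_zero, one_mul, mul_assoc], h,
        show g * f * g * (g * f * g) = g * (f * (g * g) * f) * g by group, hg, mul_one, hf,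
        mul_one, hg]
    refine key' _ _ (Equiv.swap_mul_self _ _) (Equiv.swap_mul_self _ _) ?_
    dsimp only
    rcases h2 with h2 | h2 <;> rw [← h2]
    · exact (key c).symm
    · exact key b
  · have : (b : ℕ) ≠ c := fun h => h1 (Fin.ext h)
    have comm : Equiv.swap ((b : ℕ) + 1) ((b : ℕ) + 2) * Equiv.swap ((c : ℕ) + 1) ((c : ℕ) + 2) =
        Equiv.swap ((c : ℕ) + 1) ((c : ℕ) + 2) * Equiv.swap ((b : ℕ) + 1) ((b : ℕ) + 2) := by
      ext x
      simp only [Equiv.Perm.mul_apply, Equiv.swap_apply_def]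
      split_ifs <;> omega
    dsimp only
    rw [pow_two]
    nth_rewrite 1 [comm]
    rw [mul_assoc, ← mul_assoc (Equiv.swap ((b : ℕ) + 1) ((b : ℕ) + 2)), Equiv.swap_mul_self,
      one_mul, Equiv.swap_mul_self]

/-- The permutation representation of `W(A_n)`. -/
noncomputable def permRep : W →* Equiv.Perm ℕ := cs.lift ⟨_, isLiftable_swap⟩

theorem permRep_simple (b : Fin n) :
    permRep cs (cs.simple b) = Equiv.swap ((b : ℕ) + 1) ((b : ℕ) + 2) :=
  cs.lift_apply_simple _ b

theorem permRep_sigma {h : ℕ} (h1 : 1 ≤ h) (h2 : h ≤ n) :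
    permRep cs (sigma cs h) = Equiv.swap h (h + 1) := by
  rw [sigma, dif_pos ⟨h1, h2⟩, permRep_simple]
  congr 1 <;> simp <;> omega

/-- Only the generator with index `h` moves a number across the cut between `h + 1` and `h + 2`. An
element that does so has `h` in each of its words. -/
theorem permRep_le_iff_of_not_mem {h : Fin n} {ω : List (Fin n)} (hω : h ∉ ω) (x : ℕ) :
    permRep cs (cs.wordProd ω) x ≤ (h : ℕ) + 1 ↔ x ≤ (h : ℕ) + 1 := by
  induction ω with
  | nil => simp
  | cons b ω ih =>
    simp only [List.mem_cons, not_or] at hω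
    rw [cs.wordProd_cons, map_mul, Equiv.Perm.mul_apply, permRep_simple, ← ih hω.2,
      Equiv.swap_apply_def]
    have : (h : ℕ) ≠ b := fun e => hω.1 (Fin.ext e)
    split_ifs <;> omega

theorem exists_word_of_mem_rightInvSeq {K : Set (Fin n)} {ω : List (Fin n)} (hω : ∀ b ∈ ω, b ∈ K)
    {t : W} (ht : t ∈ cs.rightInvSeq ω) :
    ∃ ω' : List (Fin n), (∀ b ∈ ω', b ∈ K) ∧ cs.wordProd ω' = t := by
  induction ω with
  | nil => simp at ht
  | cons b ω ih =>
    simp only [CoxeterSystem.rightInvSeq, List.mem_cons] at ht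
    rcases ht with rfl | ht
    · refine ⟨ω.reverse ++ b :: ω, ?_, ?_⟩
      · intro c hc
        simp only [List.mem_append, List.mem_reverse, List.mem_cons] at hc hω
        grind
      · rw [cs.wordProd_append, cs.wordProd_cons, cs.wordProd_reverse, mul_assoc]
    · exact ih (fun c hc => hω c (List.mem_cons_of_mem _ hc)) ht

/-- A reduced word of an element of a parabolic subgroup only uses the generators of this
subgroup. -/
theorem mem_of_isReduced_of_parabolic {K : Set (Fin n)} {ω ω' : List (Fin n)} (hω : cs.IsReduced ω)
    (hω' : ∀ b ∈ ω', b ∈ K) (h : cs.wordProd ω = cs.wordProd ω') : ∀ b ∈ ω, b ∈ K := by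
  induction ω using List.reverseRecOn generalizing ω' with
  | nil => simp
  | append_singleton ω c ih =>
    have hc : cs.simple c ∈ cs.rightInvSeq (ω ++ [c]) := by
      rw [← List.concat_eq_append, cs.rightInvSeq_concat]
      simp
    obtain ⟨ω'', h1, h2⟩ :=
      exists_word_of_mem_rightInvSeq cs hω' (mem_rightInvSeq_of_wordProd_eq cs hω h hc)
    have hcK : c ∈ K := by
      by_contra hcK
      -- The swap of `c + 1` and `c + 2` crosses its own cut, so every word for this reflection
      -- contains `c`.
      have := permRep_le_iff_of_not_mem cs (fun hc => hcK (h1 c hc)) ((c : ℕ) + 1)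
      rw [h2, permRep_simple, Equiv.swap_apply_left] at this
      omega
    have hred : cs.IsReduced ω := by
      have := hω.take ω.length
      rwa [List.take_left'] at this
      rfl
    have h3 : cs.wordProd ω = cs.wordProd (ω' ++ [c]) := by
      rw [cs.wordProd_append, ← h, cs.wordProd_append, mul_assoc, cs.wordProd_singleton,
        cs.simple_mul_simple_self, mul_one]
    have h4 := ih hred (ω' := ω' ++ [c]) (by
      intro b hb
      rcases List.mem_append.1 hb with hb | hb
      · exact hω' b hb
      · rw [List.mem_singleton.1 hb]; exact hcK) h3
    intro b hb
    rcases List.mem_append.1 hb with hb | hb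
    · exact h4 b hb
    · rw [List.mem_singleton.1 hb]; exact hcK

theorem wordElement_append (ω ω' : List ℕ) :
    wordElement cs (ω ++ ω') = wordElement cs ω * wordElement cs ω' := by
  simp [wordElement]

theorem exists_wordProd_eq_wordElement {ω : List ℕ} (hω : ∀ c ∈ ω, 1 ≤ c ∧ c ≤ n) :
    ∃ ω' : List (Fin n), cs.wordProd ω' = wordElement cs ω ∧ ∀ b : Fin n, b ∈ ω' ↔ (b : ℕ) + 1 ∈ ω := by
  induction ω with
  | nil => exact ⟨[], by simp [wordElement], by simp⟩
  | cons c ω ih =>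
    obtain ⟨ω', h1, h2⟩ := ih fun d hd => hω d (List.mem_cons_of_mem _ hd)
    have hc := hω c List.mem_cons_self
    refine ⟨⟨c - 1, by omega⟩ :: ω', ?_, fun b => ?_⟩
    · rw [cs.wordProd_cons, h1]
      simp only [wordElement, List.map_cons, List.prod_cons, sigma, dif_pos hc]
    · simp only [List.mem_cons, h2, Fin.ext_iff]
      have : (b : ℕ) = c - 1 ↔ (b : ℕ) + 1 = c := by omega
      rw [this]

theorem permRep_wordElement_of_ne {ω : List ℕ} (hω : ∀ c ∈ ω, 1 ≤ c ∧ c ≤ n) {z : ℕ}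
    (hz : ∀ c ∈ ω, z ≠ c ∧ z ≠ c + 1) : permRep cs (wordElement cs ω) z = z := by
  induction ω with
  | nil => simp [wordElement]
  | cons c ω ih =>
    have hc := hω c List.mem_cons_self
    have hc' := hz c List.mem_cons_self
    have := ih (fun d hd => hω d (List.mem_cons_of_mem _ hd))
      (fun d hd => hz d (List.mem_cons_of_mem _ hd))
    rw [← List.singleton_append, wordElement_append, map_mul, Equiv.Perm.mul_apply, this]
    simp only [wordElement, List.map_cons, List.map_nil, List.prod_singleton,
      permRep_sigma cs hc.1 hc.2]
    exact Equiv.swap_apply_of_ne_of_ne hc'.1 hc'.2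

theorem permRep_wordElement_Ico {x : ℕ} (hx : 1 ≤ x) (d : ℕ) (hd : x + d ≤ n) :
    permRep cs (wordElement cs (List.Ico x (x + d + 1))) (x + d + 1) = x := by
  have h1 : ∀ {c : ℕ}, 1 ≤ c → c ≤ n → permRep cs (wordElement cs [c]) (c + 1) = c := by
    intro c h1 h2
    simp only [wordElement, List.map_cons, List.map_nil, List.prod_singleton,
      permRep_sigma cs h1 h2, Equiv.swap_apply_right]
  induction d with
  | zero =>
    rw [Nat.add_zero, List.Ico.succ_singleton]
    exact h1 hx (by omega)
  | succ d ih =>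
    rw [← Nat.add_assoc, List.Ico.succ_top (by omega), wordElement_append, map_mul,
      Equiv.Perm.mul_apply, h1 (by omega) (by omega), ih (by omega)]

theorem mem_blocksWord {i j : ℕ → ℕ} {a b c : ℕ} :
    c ∈ blocksWord i j a b ↔ ∃ r, a ≤ r ∧ r < b ∧ i r ≤ c ∧ c ≤ j r := by
  simp only [blocksWord, List.mem_flatMap, List.Ico.mem, Nat.lt_succ_iff, and_assoc]

theorem blocksWord_append (i j : ℕ → ℕ) {a b c : ℕ} (hab : a ≤ b) (hbc : b ≤ c) :
    blocksWord i j a c = blocksWord i j a b ++ blocksWord i j b c := by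
  rw [blocksWord, ← List.Ico.append_consecutive hab hbc, List.flatMap_append]
  rfl

/-- The product of the blocks `a, …, b - 1` is saturated in the parabolic subgroup of its
letters. -/
theorem saturatedIn_blocksWord {p : ℕ} {i j : ℕ → ℕ} (h : IsStandardPair n p i j) {a b : ℕ}
    (ha : 1 ≤ a) (hb : b ≤ p + 1) {K : Set (Fin n)}
    (hK : ∀ k : Fin n, k ∈ K ↔ ∃ r, a ≤ r ∧ r < b ∧ i r ≤ (k : ℕ) + 1 ∧ (k : ℕ) + 1 ≤ j r) :
    SaturatedIn cs K (wordElement cs (blocksWord i j a b)) := by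
  have hlet : ∀ a' b', 1 ≤ a' → b' ≤ p + 1 → ∀ c ∈ blocksWord i j a' b', 1 ≤ c ∧ c ≤ n := by
    intro a' b' ha' hb' c hc
    obtain ⟨r, h1, h2, h3, h4⟩ := mem_blocksWord.1 hc
    have := h.bounds r (by omega) (by omega)
    omega
  obtain ⟨ω, h1, h2⟩ := exists_wordProd_eq_wordElement cs (hlet a b ha hb)
  have hω : ∀ c, c ∈ ω ↔ c ∈ K := fun c => by rw [h2, mem_blocksWord, hK]
  refine ⟨?_, Set.Subset.antisymm ?_ ?_⟩
  · rw [← h1, CoxeterSystem.wordProd]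
    refine Subgroup.list_prod_mem _ fun x hx => ?_
    obtain ⟨c, hc, rfl⟩ := List.mem_map.1 hx
    exact Subgroup.subset_closure ⟨c, (hω c).1 hc, rfl⟩
  · rintro c ⟨ω', h3, h4, h5⟩
    exact mem_of_isReduced_of_parabolic cs h3 (fun b hb => (hω b).1 hb) (h4.trans h1.symm) c h5
  · intro k hk
    obtain ⟨ω', h3, h4⟩ := cs.exists_isReduced (wordElement cs (blocksWord i j a b))
    refine ⟨ω', h3, h4.symm, ?_⟩
    by_contra h5
    obtain ⟨r, r1, r2, r3, r4⟩ := (hK k).1 hk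
    have hr := h.bounds r (by omega) (by omega)
    have h6 := permRep_le_iff_of_not_mem cs h5 (j r + 1)
    -- The blocks after `r` only move numbers up to `j r`, block `r` takes `j r + 1` to `i r`, and
    -- the blocks before `r` only move numbers above `i r`. So the product crosses the cut of every
    -- letter of block `r`, whether or not the block word is reduced.
    have h7 : permRep cs (cs.wordProd ω') (j r + 1) = i r := by
      have e1 : permRep cs (wordElement cs (blocksWord i j (r + 1) b)) (j r + 1) = j r + 1 := by
        refine permRep_wordElement_of_ne cs (hlet _ _ (by omega) hb) fun c hc => ?_
        obtain ⟨q, q1, q2, q3, q4⟩ := mem_blocksWord.1 hc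
        have := h.decr_j r q (by omega) (by omega) (by omega)
        omega
      have e2 : permRep cs (wordElement cs (blocksWord i j a r)) (i r) = i r := by
        refine permRep_wordElement_of_ne cs (hlet _ _ ha (by omega)) fun c hc => ?_
        obtain ⟨q, q1, q2, q3, q4⟩ := mem_blocksWord.1 hc
        have := h.decr_i q r (by omega) (by omega) (by omega)
        omega
      have e3 := permRep_wordElement_Ico cs hr.1 (j r - i r) (by omega)
      rw [show i r + (j r - i r) = j r by omega] at e3
      rw [← h4, blocksWord_append i j (by omega : a ≤ r + 1) (by omega : r + 1 ≤ b),
        blocksWord_succ i j r1, wordElement_append, wordElement_append, map_mul, map_mul,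
        Equiv.Perm.mul_apply, Equiv.Perm.mul_apply, e1, e3, e2]
    omega

end Coxeter

/-! ### Counting ends of strings -/

/-- The sign of a dot: `-1` for the left end of a string, `1` for the right end. -/
noncomputable def endSign (m : Dot → Dot) (d : Dot) : ℤ := if d.key < (m d).key then -1 else 1

section Sums

variable {n : ℕ} {m : Dot → Dot} {S : Finset Dot}

theorem IsMatching.endSign_add (hm : IsMatching n m) {d : Dot} (hd : d.IsOn n) :
    endSign m d + endSign m (m d) = 0 := by
  unfold endSign
  rw [hm.invol]
  rcases hm.key_lt_or_lt hd with h | h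
  · rw [if_pos h, if_neg (by omega)]; rfl
  · rw [if_neg (by omega), if_pos h]; rfl

/-- Strings with both ends in `S` cancel, so only the strings that leave `S` contribute. -/
theorem IsMatching.sum_endSign (hm : IsMatching n m) (hS : ∀ d ∈ S, d.IsOn n) :
    ∑ d ∈ S, endSign m d = ∑ d ∈ S with m d ∉ S, endSign m d := by
  have h : ∑ d ∈ S with m d ∈ S, endSign m d = 0 := by
    refine Finset.sum_involution (fun d _ => m d) (fun d hd => ?_) (fun d hd _ => ?_)
      (fun d hd => ?_) (fun d _ => hm.invol d)
    · exact hm.endSign_add (hS d (Finset.mem_filter.1 hd).1)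
    · exact hm.ne_of_isOn (hS d (Finset.mem_filter.1 hd).1)
    · have := Finset.mem_filter.1 hd
      exact Finset.mem_filter.2 ⟨this.2, by rw [hm.invol]; exact this.1⟩
  rw [← Finset.sum_filter_add_sum_filter_not S (fun d => m d ∈ S), h, zero_add]

theorem IsMatching.sum_endSign_eq_zero (hm : IsMatching n m) (hS : ∀ d ∈ S, d.IsOn n)
    (h : ∀ d ∈ S, m d ∈ S) : ∑ d ∈ S, endSign m d = 0 := by
  rw [hm.sum_endSign hS, Finset.filter_false_of_mem (fun d hd => not_not.2 (h d hd)),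
    Finset.sum_empty]

theorem IsMatching.sum_endSign_pos (hm : IsMatching n m) (hS : ∀ d ∈ S, d.IsOn n)
    (h : ∀ d ∈ S, d.key < (m d).key → m d ∈ S) {c : Dot} (hc : c ∈ S) (hmc : m c ∉ S) :
    0 < ∑ d ∈ S, endSign m d := by
  rw [hm.sum_endSign hS]
  refine Finset.sum_pos (fun d hd => ?_) ⟨c, Finset.mem_filter.2 ⟨hc, hmc⟩⟩
  have hd := Finset.mem_filter.1 hd
  rw [endSign, if_neg (fun h' => hd.2 (h d hd.1 h'))]
  exact one_pos

theorem IsMatching.sum_endSign_nonpos (hm : IsMatching n m) (hS : ∀ d ∈ S, d.IsOn n)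
    (h : ∀ d ∈ S, (m d).key < d.key → m d ∈ S) : ∑ d ∈ S, endSign m d ≤ 0 := by
  rw [hm.sum_endSign hS]
  refine Finset.sum_nonpos (fun d hd => ?_)
  have hd := Finset.mem_filter.1 hd
  rw [endSign, if_pos ((hm.key_lt_or_lt (hS d hd.1)).resolve_right fun h' => hd.2 (h d hd.1 h'))]
  norm_num

theorem IsMatching.sum_endSign_neg (hm : IsMatching n m) (hS : ∀ d ∈ S, d.IsOn n)
    (h : ∀ d ∈ S, (m d).key < d.key → m d ∈ S) {c : Dot} (hc : c ∈ S) (hmc : m c ∉ S) :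
    ∑ d ∈ S, endSign m d < 0 := by
  rw [hm.sum_endSign hS]
  refine Finset.sum_neg (fun d hd => ?_) ⟨c, Finset.mem_filter.2 ⟨hc, hmc⟩⟩
  have hd := Finset.mem_filter.1 hd
  rw [endSign, if_pos ((hm.key_lt_or_lt (hS d hd.1)).resolve_right fun h' => hd.2 (h d hd.1 h'))]
  norm_num

/-- The top dots `a + 1, …, b`. -/
noncomputable def topIoc (a b : ℕ) : Finset Dot := (Finset.Ioc a b).image Dot.top

/-- The bottom dots `(a + 1)', …, b'`. -/
noncomputable def botIoc (a b : ℕ) : Finset Dot := (Finset.Ioc a b).image Dot.bot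

@[simp] theorem top_mem_topIoc {a b x : ℕ} : Dot.top x ∈ topIoc a b ↔ a < x ∧ x ≤ b := by
  simp [topIoc]

@[simp] theorem bot_not_mem_topIoc {a b x : ℕ} : Dot.bot x ∉ topIoc a b := by
  simp [topIoc]

@[simp] theorem bot_mem_botIoc {a b x : ℕ} : Dot.bot x ∈ botIoc a b ↔ a < x ∧ x ≤ b := by
  simp [botIoc]

@[simp] theorem top_not_mem_botIoc {a b x : ℕ} : Dot.top x ∉ botIoc a b := by
  simp [botIoc]

theorem isOn_of_mem_topIoc {a b : ℕ} (hb : b ≤ n + 1) : ∀ d ∈ topIoc a b, d.IsOn n := by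
  rintro (x | x) h <;> simp at h
  exact ⟨by simp only [Dot.num]; omega, by simp only [Dot.num]; omega⟩

theorem isOn_of_mem_botIoc {a b : ℕ} (hb : b ≤ n + 1) : ∀ d ∈ botIoc a b, d.IsOn n := by
  rintro (x | x) h <;> simp at h
  exact ⟨by simp only [Dot.num]; omega, by simp only [Dot.num]; omega⟩

theorem isOn_region {x y : ℕ} : ∀ d ∈ topIoc x (n + 1) ∪ botIoc y (n + 1), d.IsOn n := by
  intro d hd
  rcases Finset.mem_union.1 hd with h | h
  · exact isOn_of_mem_topIoc le_rfl d h
  · exact isOn_of_mem_botIoc le_rfl d h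

end Sums

/-! ### Counting the terms of a decreasing sequence above a bound -/

section Rank

variable {p : ℕ} {i : ℕ → ℕ}

/-- The number of terms greater than `a` of a decreasing sequence `i₁ > ⋯ > i_p`. -/
def rankAbove (p : ℕ) (i : ℕ → ℕ) (a : ℕ) : ℕ := Nat.findGreatest (fun k => a < i k) p

theorem rankAbove_le (a : ℕ) : rankAbove p i a ≤ p := Nat.findGreatest_le p

/-- The indices of the terms above `a` form an initial segment, so the greatest of them is also
their number; `Nat.findGreatest` returns 0 if there are none. -/
theorem lt_iff_le_rankAbove (hi : ∀ s t, 1 ≤ s → s < t → t ≤ p → i t < i s) {a k : ℕ}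
    (h1 : 1 ≤ k) (h2 : k ≤ p) : a < i k ↔ k ≤ rankAbove p i a := by
  constructor
  · exact fun h => Nat.le_findGreatest (P := fun k => a < i k) h2 h
  · intro h
    have h3 : a < i (rankAbove p i a) :=
      Nat.findGreatest_of_ne_zero (P := fun k => a < i k) (n := p) rfl (by omega)
    rcases h.lt_or_eq with h | h
    · have := hi k _ h1 h (rankAbove_le a)
      omega
    · rwa [← h] at h3

theorem rankAbove_apply (hi : ∀ s t, 1 ≤ s → s < t → t ≤ p → i t < i s) {s : ℕ} (h1 : 1 ≤ s)
    (h2 : s ≤ p) : rankAbove p i (i s) = s - 1 := by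
  have h3 := (lt_iff_le_rankAbove hi h1 h2 (a := i s)).not.1 (lt_irrefl _)
  by_cases h : s = 1
  · omega
  · have h4 := (lt_iff_le_rankAbove hi (k := s - 1) (by omega) (by omega)).1
      (hi (s - 1) s (by omega) (by omega) h2)
    omega

theorem rankAbove_eq_zero {a : ℕ} (h : ∀ k, 1 ≤ k → k ≤ p → i k ≤ a) : rankAbove p i a = 0 := by
  rw [rankAbove, Nat.findGreatest_eq_zero_iff]
  intro k h1 h2
  have := h k h1 h2
  omega

theorem rankAbove_succ (hi : ∀ s t, 1 ≤ s → s < t → t ≤ p → i t < i s) (a : ℕ) :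
    open Classical in
    rankAbove p i a = rankAbove p i (a + 1) + if a + 1 ∈ valueSet p i then 1 else 0 := by
  have h1 : ∀ k, 1 ≤ k → k ≤ p → _ := fun k h1 h2 => lt_iff_le_rankAbove hi h1 h2 (a := a)
  have h2 : ∀ k, 1 ≤ k → k ≤ p → _ := fun k h1 h2 => lt_iff_le_rankAbove hi h1 h2 (a := a + 1)
  have b1 := rankAbove_le (p := p) (i := i) a
  have b2 := rankAbove_le (p := p) (i := i) (a + 1)
  split_ifs with h
  · obtain ⟨k, k1, k2, hk⟩ := h
    rw [hk, rankAbove_apply hi k1 k2]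
    have e1 := (h1 k k1 k2).1 (by omega)
    by_contra hne
    have e2 := (h1 (k + 1) (by omega) (by omega)).2 (by omega)
    have := hi k (k + 1) k1 (by omega) (by omega)
    omega
  · rw [add_zero]
    by_contra hne
    rcases Nat.lt_or_gt_of_ne hne with hlt | hlt
    · have e1 := (h2 _ (by omega) b2).2 le_rfl
      have e2 := (h1 _ (by omega) b2).1 (by omega)
      omega
    · have e1 := (h1 _ (by omega) b1).2 le_rfl
      have e2 := (h2 _ (by omega) b1).not.2 (by omega)
      exact h ⟨_, by omega, b1, by omega⟩

/-- The summand at `x` is the increment of the potential `x + 2 * rankAbove p i x`, so the sum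
telescopes. -/
theorem sum_valueSet (hi : ∀ s t, 1 ≤ s → s < t → t ≤ p → i t < i s) {a b : ℕ} (hab : a ≤ b) :
    open Classical in
    ∑ x ∈ Finset.Ioc a b, (if x ∈ valueSet p i then (-1 : ℤ) else 1) =
      (b + 2 * rankAbove p i b) - (a + 2 * rankAbove p i a) := by
  classical
  induction b, hab using Nat.le_induction with
  | base => simp
  | succ b hab ih =>
    rw [Finset.sum_Ioc_succ_top (by omega), ih]
    have := rankAbove_succ hi b
    rw [this]
    split_ifs <;> push_cast <;> ring

end Rank

/-! ### Balance of string ends and the positive arrows -/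

section Diagram

variable {n p : ℕ} {m : Dot → Dot} {i j : ℕ → ℕ}

/-- The involution `m` is the diagram with left ends `i₁ > ⋯ > i_p` in the top row and right ends
`j₁ + 1 > ⋯ > j_p + 1` in the bottom row. -/
structure IsCanonical (n p : ℕ) (i j : ℕ → ℕ) (m : Dot → Dot) : Prop where
  pair : IsStandardPair n p i j
  matching : IsMatching n m
  oriented : Oriented m (valueSet p i) (valueSet p j)

namespace IsCanonical

variable (hc : IsCanonical n p i j m)
include hc

theorem sum_topIoc {a b : ℕ} (hab : a ≤ b) : ∑ d ∈ topIoc a b, endSign m d =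
    (b + 2 * rankAbove p i b) - (a + 2 * rankAbove p i a) := by
  classical
  rw [topIoc, Finset.sum_image (fun x _ y _ h => Dot.top.inj h), ← sum_valueSet hc.pair.decr_i hab]
  refine Finset.sum_congr rfl fun x _ => ?_
  simp only [endSign, hc.oriented.top_iff]

theorem decr_j_succ : ∀ s t, 1 ≤ s → s < t → t ≤ p → j t + 1 < j s + 1 := fun s t h1 h2 h3 => by
  have := hc.pair.decr_j s t h1 h2 h3
  omega

theorem sum_botIoc {a b : ℕ} (hab : a ≤ b) (hb : b ≤ n + 1) : ∑ d ∈ botIoc a b, endSign m d =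
    (a + 2 * rankAbove p (fun k => j k + 1) a) - (b + 2 * rankAbove p (fun k => j k + 1) b) := by
  classical
  have := sum_valueSet hc.decr_j_succ hab
  rw [botIoc, Finset.sum_image (fun x _ y _ h => Dot.bot.inj h), ← neg_sub, ← this,
    ← Finset.sum_neg_distrib]
  refine Finset.sum_congr rfl fun x hx => ?_
  rw [Finset.mem_Ioc] at hx
  have h1 := hc.oriented.bot_iff x
  have h2 := hc.matching.key_lt_or_lt (isOn_bot (by omega) (by omega) : (Dot.bot x).IsOn n)
  have h3 : x ∈ valueSet p (fun k => j k + 1) ↔ ∃ y ∈ valueSet p j, x = y + 1 := by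
    constructor
    · rintro ⟨k, k1, k2, rfl⟩
      exact ⟨j k, ⟨k, k1, k2, rfl⟩, rfl⟩
    · rintro ⟨_, ⟨k, k1, k2, rfl⟩, rfl⟩
      exact ⟨k, k1, k2, rfl⟩
  rw [← h3] at h1
  unfold endSign
  split_ifs with h4 h5 h5
  · have := h1.2 h5
    omega
  · rfl
  · rfl
  · exact absurd (h1.1 (by omega)) h5

theorem sum_region {x y : ℕ} (hx : x ≤ n + 1) (hy : y ≤ n + 1) :
    ∑ d ∈ topIoc x (n + 1) ∪ botIoc y (n + 1), endSign m d =
      (y + 2 * rankAbove p (fun k => j k + 1) y) - (x + 2 * rankAbove p i x) := by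
  rw [Finset.sum_union, hc.sum_topIoc hx, hc.sum_botIoc hy le_rfl]
  · have e1 : rankAbove p i (n + 1) = 0 := rankAbove_eq_zero fun k h1 h2 => by
      have := hc.pair.bounds k h1 h2
      omega
    have e2 : rankAbove p (fun k => j k + 1) (n + 1) = 0 := rankAbove_eq_zero fun k h1 h2 => by
      have := hc.pair.bounds k h1 h2
      omega
    rw [e1, e2]
    ring
  · rw [Finset.disjoint_left]
    rintro (d | d) h <;> simp at h ⊢

/-- The dots right of a string from top to bottom are joined to each other. -/
theorem mem_region {x y : ℕ} (h : m (.top x) = .bot y)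
    (hy : y ≤ n + 1) {d : Dot} (hd : d ∈ topIoc x (n + 1) ∪ botIoc y (n + 1)) :
    m d ∈ topIoc x (n + 1) ∪ botIoc y (n + 1) := by
  have hon := isOn_region d hd
  have hon' := hc.matching.isOn_apply hon
  have hxn : x ≤ n + 1 := (hc.matching.isOn_of_ne (x := .top x) (by simp [h])).2
  have h1 : (Dot.top x).pos n < d.pos n ∧ d.pos n < (m (.top x)).pos n := by
    rw [h]
    rcases d with u | u <;> simp at hd <;> simp only [Dot.pos] <;> omega
  have h2 := hc.matching.nested _ _ h1.1 h1.2
  rw [h] at h2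
  rcases e : m d with u | u <;> rw [e] at hon' h2 <;>
    simp only [Dot.pos, Dot.IsOn, Dot.num] at h2 hon' <;> simp <;> omega

/-- The region to the right of the string is closed under `m`, so its left and right ends balance.
-/
theorem eq_of_arrow {x y : ℕ} (h : m (.top x) = .bot y) (hxn : x ≤ n + 1)
    (hy : y ≤ n + 1) : y + 2 * rankAbove p (fun k => j k + 1) y = x + 2 * rankAbove p i x := by
  have h1 := hc.matching.sum_endSign_eq_zero isOn_region (fun d hd => hc.mem_region h hy hd)
  rw [hc.sum_region hxn hy] at h1
  omega

/-- A left end among the dots `(z + 1)', …, y'` leads to the right and cannot cross the arrow, so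
its string stays among them. The dot `y'` is a right end whose string leaves, hence the sum of signs
is positive. -/
theorem bot_lt_of_arrow {x y z : ℕ} (h : m (.top x) = .bot y) (hy : y ≤ n + 1)
    (hxz : x ≤ z) (hzy : z < y) :
    y + 2 * rankAbove p (fun k => j k + 1) y < z + 2 * rankAbove p (fun k => j k + 1) z := by
  have h0 : m (.bot y) = .top x := by rw [← h, hc.matching.invol]
  have h1 : 0 < ∑ d ∈ botIoc z y, endSign m d := by
    refine hc.matching.sum_endSign_pos (c := .bot y) (isOn_of_mem_botIoc hy) ?_ (by simp [hzy])
      (by simp [h0])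
    rintro (q | q) hq hk <;> simp at hq
    have hqy : q ≠ y := by
      rintro rfl
      rw [h0] at hk
      simp only [Dot.key] at hk
      omega
    have hon := hc.matching.isOn_apply (isOn_bot (by omega) (by omega) : (Dot.bot q).IsOn n)
    have hR : m (.bot q) ∉ topIoc x (n + 1) ∪ botIoc y (n + 1) := fun h' => by
      have := hc.mem_region h hy h'
      rw [hc.matching.invol] at this
      simp at this
      omega
    have hne : m (.bot q) ≠ .bot y := fun h' => by
      have : Dot.bot q = .top x := by rw [← hc.matching.invol (.bot q), h', h0]
      cases this
    rcases e : m (.bot q) with u | u <;> rw [e] at hk hon hR hne <;>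
      simp only [Dot.key, Dot.IsOn, Dot.num, Finset.mem_union, top_mem_topIoc, bot_mem_botIoc,
        bot_not_mem_topIoc, top_not_mem_botIoc, false_or, or_false] at hk hon hR
    · omega
    · have : u ≠ y := fun h => hne (congrArg _ h)
      simp only [bot_mem_botIoc]
      omega
  rw [hc.sum_botIoc (by omega) hy] at h1
  omega

/-- A string whose right end is one of these dots cannot cross the arrow, and the bottom dots on
this side of it lie beyond `y > h'`. So its left end is in the top row, after `x`. -/
theorem top_right_end_of_arrow {x y h' : ℕ} (h : m (.top x) = .bot y)
    (hy : y ≤ n + 1) (hhy : h' < y) :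
    ∀ d ∈ topIoc x h', (m d).key < d.key → m d ∈ topIoc x h' := by
  rintro (q | q) hq hk <;> simp at hq
  have hR := hc.mem_region h hy (d := .top q) (by simp; omega)
  rcases e : m (.top q) with u | u <;> rw [e] at hk hR <;>
    simp only [Dot.key, Finset.mem_union, top_mem_topIoc, bot_mem_botIoc,
      bot_not_mem_topIoc, top_not_mem_botIoc, false_or, or_false] at hk hR
  · simp only [top_mem_topIoc]
    omega
  · omega

theorem top_le_of_arrow {x y h' : ℕ} (h : m (.top x) = .bot y) (hy : y ≤ n + 1)
    (hxh : x ≤ h') (hhy : h' < y) :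
    h' + 2 * rankAbove p i h' ≤ x + 2 * rankAbove p i x := by
  have h1 := hc.matching.sum_endSign_nonpos (isOn_of_mem_topIoc (by omega))
    (hc.top_right_end_of_arrow h hy hhy)
  rw [hc.sum_topIoc hxh] at h1
  omega

/-- The inequality becomes strict because `h'` is a left end, so its string leaves the interval. -/
theorem top_lt_of_arrow {x y h' : ℕ} (h : m (.top x) = .bot y) (hy : y ≤ n + 1)
    (hxh : x < h') (hhy : h' < y) (hI : h' ∈ valueSet p i) :
    h' + 2 * rankAbove p i h' < x + 2 * rankAbove p i x := by
  have h0 := (hc.oriented.top_iff h').2 hI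
  have h1 := hc.matching.sum_endSign_neg (c := .top h') (isOn_of_mem_topIoc (by omega))
    (hc.top_right_end_of_arrow h hy hhy) (by simp [hxh]) (by
      rcases e : m (.top h') with u | u
      · rw [e] at h0
        simp only [Dot.key] at h0
        simp only [top_mem_topIoc]
        omega
      · simp)
  rw [hc.sum_topIoc hxh.le] at h1
  omega

theorem rankAbove_j {t : ℕ} (h1 : 1 ≤ t) (h2 : t ≤ p) :
    rankAbove p (fun k => j k + 1) (j t + 1) = t - 1 :=
  rankAbove_apply hc.decr_j_succ h1 h2

theorem rankAbove_i {t : ℕ} (h1 : 1 ≤ t) (h2 : t ≤ p) : rankAbove p i (i t) = t - 1 :=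
  rankAbove_apply hc.pair.decr_i h1 h2

/-- The equality and the minimality condition for a positive arrow. -/
theorem rule_of_arrow {s t : ℕ} (hs : 1 ≤ s) (hsp : s ≤ p) (ht : 1 ≤ t) (htp : t ≤ p)
    (h : m (.top (i s)) = .bot (j t + 1)) (hlt : i s < j t + 1) :
    t < s ∧ (j t : ℤ) = i s + 2 * ((s : ℤ) - t) - 1 ∧ ∀ r, t < r → r < s →
      (j r : ℤ) ≠ i s + 2 * ((s : ℤ) - r) - 1 ∧ (j t : ℤ) ≠ i r + 2 * ((r : ℤ) - t) - 1 := by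
  have bs := hc.pair.bounds s hs hsp
  have bt := hc.pair.bounds t ht htp
  have e := hc.eq_of_arrow h (by omega) (by omega)
  rw [hc.rankAbove_j ht htp, hc.rankAbove_i hs hsp] at e
  refine ⟨by omega, by omega, fun r h1 h2 => ⟨fun h3 => ?_, fun h3 => ?_⟩⟩
  · have br := hc.pair.bounds r (by omega) (by omega)
    have dr := hc.pair.decr_j t r ht h1 (by omega)
    -- The excluded equality says that `j r + 1` and `j t + 1` have the same bottom potential. In
    -- the other case `i r` and `i s` would have the same top potential.
    have := hc.bot_lt_of_arrow (z := j r + 1) h (by omega) (by omega) (by omega)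
    rw [hc.rankAbove_j ht htp, hc.rankAbove_j (by omega) (by omega)] at this
    omega
  · have br := hc.pair.bounds r (by omega) (by omega)
    have dr := hc.pair.decr_i r s (by omega) h2 (by omega)
    have := hc.top_lt_of_arrow (h' := i r) h (by omega) (by omega) (by omega)
      ⟨r, by omega, by omega, rfl⟩
    rw [hc.rankAbove_i hs hsp, hc.rankAbove_i (by omega) (by omega)] at this
    omega

/-- The blocks between the ends of a positive arrow cover all numbers between these ends. -/
theorem cover_of_arrow {s t : ℕ} (hs : 1 ≤ s) (hsp : s ≤ p) (ht : 1 ≤ t) (htp : t ≤ p)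
    (h : m (.top (i s)) = .bot (j t + 1)) {h' : ℕ} (h1 : i s < h') (h2 : h' < j t) :
    ∃ r, t < r ∧ r < s ∧ i r ≤ h' ∧ h' ≤ j r := by
  have bs := hc.pair.bounds s hs hsp
  have bt := hc.pair.bounds t ht htp
  have e := hc.eq_of_arrow h (by omega) (by omega)
  have e1 := hc.bot_lt_of_arrow (z := h') h (by omega) (by omega) (by omega)
  have e2 := hc.top_le_of_arrow (h' := h') h (by omega) (by omega) (by omega)
  rw [hc.rankAbove_j ht htp] at e e1
  rw [hc.rankAbove_i hs hsp] at e e2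
  -- By `e`, `e1` and `e2` fewer terms `i k` exceed `h'` than terms `j k + 1`. Every index beyond
  -- the first count and up to the second gives a block containing `h'`; the minimum with `s - 1`
  -- keeps the index below `s`.
  refine ⟨min (rankAbove p (fun k => j k + 1) h') (s - 1), by omega, by omega, ?_, ?_⟩
  · have := lt_iff_le_rankAbove hc.pair.decr_i (a := h')
      (k := min (rankAbove p (fun k => j k + 1) h') (s - 1)) (by omega) (by omega)
    omega
  · have := lt_iff_le_rankAbove hc.decr_j_succ (a := h')
      (k := min (rankAbove p (fun k => j k + 1) h') (s - 1)) (by omega) (by omega)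
    omega

/-- The string from `top x` ends in the top row: the dots below it are joined to each other. -/
theorem eq_of_top_arc {x v : ℕ} (h : m (.top x) = .top v) (hxv : x < v) (hvn : v ≤ n + 1) :
    v - 1 + 2 * rankAbove p i (v - 1) = x + 2 * rankAbove p i x := by
  have h1 := hc.matching.sum_endSign_eq_zero (S := topIoc x (v - 1))
    (isOn_of_mem_topIoc (by omega)) (by
      rintro (u | u) hu <;> simp at hu
      have hon := hc.matching.isOn_apply (isOn_top (by omega) (by omega) : (Dot.top u).IsOn n)
      have := hc.matching.nested (.top x) (.top u) (by simp only [Dot.pos]; omega)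
        (by rw [h]; simp only [Dot.pos]; omega)
      rw [h] at this
      rcases e : m (.top u) with w | w <;> rw [e] at this hon <;>
        simp only [Dot.pos, Dot.IsOn, Dot.num] at this hon <;> simp <;> omega)
  rw [hc.sum_topIoc (by omega)] at h1
  omega

/-- Strings leave this region only through their right ends: a left end under the arc stays in the
top row, and the others lead to dots beyond `x` or `y`. The head `v` of the arc is a right end whose
string does leave. -/
theorem lt_of_top_arc {x v y : ℕ} (h : m (.top x) = .top v) (hxv : x < v) (hvn : v ≤ n + 1)
    (hxy : x < y) (hyv : y ≤ v + 1) (hyn : y ≤ n + 1) :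
    x + 2 * rankAbove p i x < y + 2 * rankAbove p (fun k => j k + 1) y := by
  have h' : m (.top v) = .top x := by rw [← h, hc.matching.invol]
  have h1 : 0 < ∑ d ∈ topIoc x (n + 1) ∪ botIoc y (n + 1), endSign m d := by
    refine hc.matching.sum_endSign_pos (c := .top v) isOn_region ?_ (by simp; omega) (by simp [h'])
    intro d hd hk
    have hon := isOn_region d hd
    have hon' := hc.matching.isOn_apply hon
    rcases d with u | u <;> simp at hd
    · have huv : u ≠ v := by
        rintro rfl
        rw [h'] at hk
        simp only [Dot.key] at hk
        omega
      rcases e : m (.top u) with w | w <;> rw [e] at hk hon' <;>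
        simp only [Dot.key, Dot.IsOn, Dot.num] at hk hon'
      · simp; omega
      · have : ¬ u < v := fun huv => by
          have := hc.matching.nested (.top x) (.top u) (by simp only [Dot.pos]; omega)
            (by rw [h]; simp only [Dot.pos]; omega)
          rw [h, e] at this
          simp only [Dot.pos] at this
          omega
        simp; omega
    · rcases e : m (.bot u) with w | w <;> rw [e] at hk hon' <;>
        simp only [Dot.key, Dot.IsOn, Dot.num] at hk hon' <;> simp <;> omega
  rw [hc.sum_region (by omega) hyn] at h1
  omega

/-- The equality and the minimality condition force a positive arrow. -/
theorem arrow_of_rule {s t : ℕ} (ht : 1 ≤ t) (hts : t < s) (hsp : s ≤ p)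
    (heq : (j t : ℤ) = i s + 2 * ((s : ℤ) - t) - 1)
    (hmin : ∀ r, t < r → r < s →
      (j r : ℤ) ≠ i s + 2 * ((s : ℤ) - r) - 1 ∧ (j t : ℤ) ≠ i r + 2 * ((r : ℤ) - t) - 1) :
    m (.top (i s)) = .bot (j t + 1) := by
  have bs := hc.pair.bounds s (by omega) hsp
  have bt := hc.pair.bounds t ht (by omega)
  have hleft := (hc.oriented.top_iff (i s)).2 ⟨s, by omega, hsp, rfl⟩
  have hon := hc.matching.isOn_apply (isOn_top bs.1 (by omega) : (Dot.top (i s)).IsOn n)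
  rcases e : m (.top (i s)) with v | v <;> rw [e] at hleft hon <;>
    simp only [Dot.key, Dot.IsOn, Dot.num] at hleft hon
  · exfalso
    -- The left side starts at most at `j t` and grows by at most 1 with each step of `r`; as it
    -- never equals `j t`, it cannot pass it.
    have hgap : ∀ r, t + 1 ≤ r → r < s → (i r : ℤ) + 2 * ((r : ℤ) - t) - 1 < j t := by
      intro r hr
      induction r, hr using Nat.le_induction with
      | base =>
        intro h
        have h1 := hc.pair.bounds (t + 1) (by omega) (by omega)
        have h2 := hc.pair.decr_j t (t + 1) ht (by omega) (by omega)
        have h3 := (hmin (t + 1) (by omega) h).2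
        push_cast at h3 ⊢
        omega
      | succ r hr ih =>
        intro h
        have h1 := ih (by omega)
        have h2 := hc.pair.decr_i r (r + 1) (by omega) (by omega) (by omega)
        have h3 := (hmin (r + 1) (by omega) h).2
        push_cast at h3 ⊢
        omega
    have e' : m (.top v) = .top (i s) := by rw [← e, hc.matching.invol]
    have hv : v ∉ valueSet p i := fun h => by
      have := (hc.oriented.top_iff v).2 h
      rw [e'] at this
      simp only [Dot.key] at this
      omega
    have h1 := hc.eq_of_top_arc e (by omega) hon.2
    rw [hc.rankAbove_i (by omega) hsp] at h1
    set r := rankAbove p i (v - 1) with hr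
    have hrp : r ≤ p := rankAbove_le _
    -- Otherwise `i r ≥ v`, and `i r ≠ v` because `v` is a right end; with the balance `h1` this
    -- contradicts `hgap`.
    have hrt : r ≤ t := by
      by_contra hrt
      have h2 := hgap r (by omega) (by omega)
      have h3 : v - 1 < i r :=
        (lt_iff_le_rankAbove hc.pair.decr_i (by omega) hrp).2 le_rfl
      exact hv ⟨r, by omega, hrp, by omega⟩
    -- Now `h1` gives `j t ≤ v`, so the strict inequality applies at `j t + 1`, where `heq` demands
    -- equality of the potentials.
    have h2 := hc.lt_of_top_arc e (by omega) hon.2 (y := j t + 1) (by omega) (by omega) (by omega)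
    rw [hc.rankAbove_j ht (by omega), hc.rankAbove_i (by omega) hsp] at h2
    omega
  · have e' : m (.bot v) = .top (i s) := by rw [← e, hc.matching.invol]
    obtain ⟨_, ⟨q, hq, hqp, rfl⟩, rfl⟩ := (hc.oriented.bot_iff v).1 (by
      rw [e']
      simp only [Dot.key]
      omega)
    obtain ⟨h1, h2, h3⟩ := hc.rule_of_arrow (by omega) hsp hq hqp e (by omega)
    -- Both `q` and `t` satisfy the equality with `s`, so the minimality of the larger interval
    -- excludes `q ≠ t`.
    rcases lt_trichotomy q t with h | h | h
    · exact absurd heq (h3 t h hts).1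
    · rw [h]
    · exact absurd h2 (hmin q h h1).1

end IsCanonical

end Diagram

/-! ### The arrows of a canonical diagram -/

section Arrows

variable {m : Dot → Dot} {x y : ℕ}

theorem mem_topArrows_arrows {a : Arrow} : a ∈ topArrows (arrows m) ↔
    ∃ x y, x < y ∧ m (.top x) = .top y ∧ a = (.top x, .top y) := by
  constructor
  · rintro ⟨⟨h1, h2⟩, x, y, rfl⟩
    exact ⟨x, y, h1, h2, rfl⟩
  · rintro ⟨x, y, h1, h2, rfl⟩
    exact ⟨⟨h1, h2⟩, x, y, rfl⟩

theorem mem_botArrows_arrows {a : Arrow} : a ∈ botArrows (arrows m) ↔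
    ∃ x y, x < y ∧ m (.bot x) = .bot y ∧ a = (.bot x, .bot y) := by
  constructor
  · rintro ⟨⟨h1, h2⟩, x, y, rfl⟩
    exact ⟨x, y, h1, h2, rfl⟩
  · rintro ⟨x, y, h1, h2, rfl⟩
    exact ⟨⟨h1, h2⟩, x, y, rfl⟩

theorem mem_posArrows_arrows {a : Arrow} : a ∈ posArrows (arrows m) ↔
    ∃ x y, x < y ∧ m (.top x) = .bot y ∧ a = (.top x, .bot y) := by
  constructor
  · rintro ⟨⟨h1, h2⟩, x, y, h, rfl⟩
    exact ⟨x, y, h, h2, rfl⟩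
  · rintro ⟨x, y, h1, h2, rfl⟩
    exact ⟨⟨trivial, h2⟩, x, y, h1, rfl⟩

theorem top_mem_tails_posArrows :
    Dot.top x ∈ tails (posArrows (arrows m)) ↔ ∃ y, x < y ∧ m (.top x) = .bot y := by
  constructor
  · rintro ⟨d, hd⟩
    obtain ⟨x', y, h1, h2, h⟩ := mem_posArrows_arrows.1 hd
    obtain ⟨h, -⟩ := Prod.mk.inj h
    obtain rfl := Dot.top.inj h
    exact ⟨y, h1, h2⟩
  · rintro ⟨y, h1, h2⟩
    exact ⟨.bot y, mem_posArrows_arrows.2 ⟨x, y, h1, h2, rfl⟩⟩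

theorem bot_mem_heads_posArrows :
    Dot.bot y ∈ heads (posArrows (arrows m)) ↔ ∃ x, x < y ∧ m (.top x) = .bot y := by
  constructor
  · rintro ⟨d, hd⟩
    obtain ⟨x, y', h1, h2, h⟩ := mem_posArrows_arrows.1 hd
    obtain ⟨-, h⟩ := Prod.mk.inj h
    obtain rfl := Dot.bot.inj h
    exact ⟨x, h1, h2⟩
  · rintro ⟨x, h1, h2⟩
    exact ⟨.top x, mem_posArrows_arrows.2 ⟨x, y, h1, h2, rfl⟩⟩

end Arrows

/-! ### The five descriptions for a canonical matching -/

namespace IsCanonical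

variable {n p : ℕ} {m : Dot → Dot} {i j : ℕ → ℕ} (hc : IsCanonical n p i j m)
include hc

theorem setI_eq : setI n (arrows m) = valueSet p i := by
  ext x
  rw [← hc.oriented.top_iff]
  constructor
  · rintro ⟨-, -, d, hd | hd⟩
    · obtain ⟨x', y, h1, h2, h⟩ := mem_topArrows_arrows.1 hd
      obtain rfl := Dot.top.inj (Prod.mk.inj h).1
      rw [h2]
      simp only [Dot.key]
      omega
    · obtain ⟨x', y, h1, h2, h⟩ := mem_posArrows_arrows.1 hd
      obtain rfl := Dot.top.inj (Prod.mk.inj h).1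
      rw [h2]
      simp only [Dot.key]
      omega
  · intro h
    have hon : (Dot.top x).IsOn n := hc.matching.isOn_of_ne fun h' => by rw [h'] at h; omega
    refine ⟨hon.1, hon.2, m (.top x), ?_⟩
    rcases e : m (.top x) with y | y <;> rw [e] at h <;> simp only [Dot.key] at h
    · exact Or.inl (mem_topArrows_arrows.2 ⟨x, y, by omega, e, rfl⟩)
    · exact Or.inr (mem_posArrows_arrows.2 ⟨x, y, by omega, e, rfl⟩)

theorem setJ_eq : setJ n (arrows m) = valueSet p j := by
  ext x
  have key : x ∈ valueSet p j ↔ (m (.bot (x + 1))).key < (Dot.bot (x + 1)).key := by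
    rw [hc.oriented.bot_iff]
    constructor
    · exact fun h => ⟨x, h, rfl⟩
    · rintro ⟨y, hy, h⟩
      rwa [show x = y by omega]
  constructor
  · rintro ⟨-, -, d, hd | hd⟩ <;> rw [key]
    · obtain ⟨y, x', h1, h2, h⟩ := mem_botArrows_arrows.1 hd
      obtain rfl := Dot.bot.inj (Prod.mk.inj h).2
      rw [← h2, hc.matching.invol, h2]
      simp only [Dot.key]
      omega
    · obtain ⟨y, x', h1, h2, h⟩ := mem_posArrows_arrows.1 hd
      obtain rfl := Dot.bot.inj (Prod.mk.inj h).2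
      rw [← h2, hc.matching.invol, h2]
      simp only [Dot.key]
      omega
  · intro hx
    have h := key.1 hx
    obtain ⟨k, k1, k2, rfl⟩ := hx
    have hb := hc.pair.bounds k k1 k2
    refine ⟨by omega, by omega, m (.bot (j k + 1)), ?_⟩
    have e' := hc.matching.invol (.bot (j k + 1))
    rcases e : m (.bot (j k + 1)) with y | y <;> rw [e] at h e' <;> simp only [Dot.key] at h
    · exact Or.inr (mem_posArrows_arrows.2 ⟨y, _, by omega, e', rfl⟩)
    · exact Or.inl (mem_botArrows_arrows.2 ⟨y, _, by omega, e', rfl⟩)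

/-- The ends of a positive arrow. -/
theorem exists_of_positive {x y : ℕ} (hxy : x < y) (h : m (.top x) = .bot y) :
    ∃ t s, 1 ≤ t ∧ t < s ∧ s ≤ p ∧ x = i s ∧ y = j t + 1 := by
  have h' : m (.bot y) = .top x := by rw [← h, hc.matching.invol]
  obtain ⟨s, s1, s2, rfl⟩ := (hc.oriented.top_iff x).1 (by rw [h]; simp only [Dot.key]; omega)
  obtain ⟨_, ⟨t, t1, t2, rfl⟩, rfl⟩ :=
    (hc.oriented.bot_iff y).1 (by rw [h']; simp only [Dot.key]; omega)
  exact ⟨t, s, t1, (hc.rule_of_arrow s1 s2 t1 t2 h hxy).1, s2, rfl, rfl⟩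

theorem posArrows_eq {W : Type*} [Group W] (cs : CoxeterSystem (CoxeterMatrix.A n) W) :
    posArrows (arrows m) = {a | ∃ t s, 1 ≤ t ∧ t < s ∧ s ≤ p ∧ PositiveRule cs i j t s ∧
      a = (.top (i s), .bot (j t + 1))} := by
  ext a
  rw [mem_posArrows_arrows]
  constructor
  · rintro ⟨x, y, hxy, h, rfl⟩
    obtain ⟨t, s, t1, hts, s2, rfl, rfl⟩ := hc.exists_of_positive hxy h
    obtain ⟨-, h1, h2⟩ := hc.rule_of_arrow (by omega) s2 t1 (by omega) h hxy
    refine ⟨t, s, t1, hts, s2, ⟨h1, h2, ?_⟩, rfl⟩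
    refine saturatedIn_blocksWord cs hc.pair (by omega) (by omega) fun k => ?_
    constructor
    · rintro ⟨h3, h4⟩
      obtain ⟨r, r1, r2, r3, r4⟩ := hc.cover_of_arrow (by omega) s2 t1 (by omega) h
        (h' := (k : ℕ) + 1) (by omega) (by omega)
      exact ⟨r, by omega, r2, r3, r4⟩
    · rintro ⟨r, r1, r2, r3, r4⟩
      have d1 := hc.pair.decr_i r s (by omega) r2 s2
      have d2 := hc.pair.decr_j t r t1 (by omega) (by omega)
      exact ⟨by omega, by omega⟩
  · rintro ⟨t, s, t1, hts, s2, hr, rfl⟩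
    exact ⟨_, _, by have := hr.eq; omega, hc.arrow_of_rule t1 hts s2 hr.eq hr.minimal, rfl⟩

theorem mem_setA {r x : ℕ} (hr : 1 ≤ r) (hrp : r ≤ p) :
    x ∈ setA i j (posArrows (arrows m)) r ↔
      Dot.top (i r) ∉ tails (posArrows (arrows m)) ∧ i r < x ∧ x ≤ j 1 + 1 ∧
      (∀ k, 1 ≤ k → k < r → x ≠ i k) ∧
      (∀ k, 1 ≤ k → k < r → (setA i j (posArrows (arrows m)) k).Nonempty →
        x ≠ sInf (setA i j (posArrows (arrows m)) k)) := by
  rw [setA]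
  split_ifs with h
  · subst h
    -- A positive tail has index `s > t ≥ 1`, so the special clause for `r = 1` agrees with the
    -- general one.
    have h1 : Dot.top (i 1) ∉ tails (posArrows (arrows m)) := by
      rw [top_mem_tails_posArrows]
      rintro ⟨y, h1, h2⟩
      obtain ⟨t, s, t1, hts, s2, e, -⟩ := hc.exists_of_positive h1 h2
      have := hc.pair.decr_i 1 s le_rfl (by omega) s2
      omega
    constructor
    · rintro ⟨h2, h3⟩
      exact ⟨h1, h2, h3, fun k _ _ => by omega, fun k _ _ => by omega⟩
    · rintro ⟨-, h2, h3, -⟩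
      exact ⟨h2, h3⟩
  · constructor
    · rintro ⟨h1, ⟨h2, h3⟩, h4, h5⟩
      exact ⟨h1, h2, h3, h4, h5⟩
    · rintro ⟨h1, h2, h3, h4, h5⟩
      exact ⟨h1, ⟨h2, h3⟩, h4, h5⟩

/-- The string at `top (i r)` ends in the top row at `v` if and only if `v = min A(r)`. -/
theorem apply_top_iff {r : ℕ} (hr : 1 ≤ r) (hrp : r ≤ p) (v : ℕ) :
    m (.top (i r)) = .top v ↔ (setA i j (posArrows (arrows m)) r).Nonempty ∧
      v = sInf (setA i j (posArrows (arrows m)) r) := by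
  induction r using Nat.strong_induction_on generalizing v with
  | _ r ih =>
    have br := hc.pair.bounds r hr hrp
    have hleft := (hc.oriented.top_iff (i r)).2 ⟨r, hr, hrp, rfl⟩
    have hon := hc.matching.isOn_apply (isOn_top br.1 (by omega) : (Dot.top (i r)).IsOn n)
    rcases e : m (.top (i r)) with u | u <;> rw [e] at hleft hon <;>
      simp only [Dot.key, Dot.IsOn, Dot.num] at hleft hon
    · have e' : m (.top u) = .top (i r) := by rw [← e, hc.matching.invol]
      have hu : u ∉ valueSet p i := fun h => by
        have := (hc.oriented.top_iff u).2 h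
        rw [e'] at this
        simp only [Dot.key] at this
        omega
      have hmem : u ∈ setA i j (posArrows (arrows m)) r := by
        rw [hc.mem_setA hr hrp]
        refine ⟨?_, by omega, ?_, ?_, ?_⟩
        · rw [top_mem_tails_posArrows]
          rintro ⟨y, -, h⟩
          rw [e] at h
          cases h
        · by_contra h
          -- Beyond `j 1 + 1` all strings are vertical, which gives the upper bound in `A(r)`.
          have := hc.oriented.apply_bot_of_gt hc.matching (b := u) (x := u) (by
            rintro _ ⟨k, k1, k2, rfl⟩
            rcases k1.lt_or_eq with hk | rfl
            · have := hc.pair.decr_j 1 k le_rfl hk k2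
              omega
            · omega) (by omega) le_rfl hon.2
          have h2 := hc.matching.invol (.bot u)
          rw [this, e'] at h2
          cases h2
        · rintro k k1 k2 rfl
          exact hu ⟨k, k1, by omega, rfl⟩
        · rintro k k1 k2 h1 h2
          have := (ih k k2 k1 (by omega) u).2 ⟨h1, h2⟩
          have h3 := Dot.top.inj (hc.matching.injective (this.trans e.symm))
          have := hc.pair.decr_i k r k1 k2 hrp
          omega
      -- A smaller candidate `x` lies under the arc and is no left end, so it is the head of an arc
      -- from some `i k > i r`. Then `k < r` and by induction `x` was excluded as the minimum of
      -- `A(k)`.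
      have hmin : ∀ x ∈ setA i j (posArrows (arrows m)) r, u ≤ x := by
        intro x hx
        obtain ⟨-, h2, -, h4, h5⟩ := (hc.mem_setA hr hrp).1 hx
        by_contra hxu
        have hnest := hc.matching.nested (.top (i r)) (.top x) (by simp only [Dot.pos]; omega)
          (by rw [e]; simp only [Dot.pos]; omega)
        have hxI : x ∉ valueSet p i := by
          rintro ⟨k, k1, k2, rfl⟩
          refine h4 k k1 ?_ rfl
          rcases lt_trichotomy k r with h | h | h
          · exact h
          · rw [h] at h2
            omega
          · have := hc.pair.decr_i r k hr h k2
            omega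
        have hxon : (Dot.top x).IsOn n := isOn_top (by omega) (by omega)
        have hright := (hc.matching.key_lt_or_lt hxon).resolve_left
          fun h => hxI ((hc.oriented.top_iff x).1 h)
        have hmon := hc.matching.isOn_apply hxon
        rw [e] at hnest
        rcases f : m (.top x) with w | w <;> rw [f] at hnest hright hmon <;>
          simp only [Dot.pos, Dot.key, Dot.IsOn, Dot.num] at hnest hright hmon
        · have f' : m (.top w) = .top x := by rw [← f, hc.matching.invol]
          obtain ⟨k, k1, k2, rfl⟩ := (hc.oriented.top_iff w).1 (by
            rw [f']; simp only [Dot.key]; omega)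
          have hkr : k < r := by
            rcases lt_trichotomy k r with h | h | h
            · exact h
            · rw [h] at hnest
              omega
            · have := hc.pair.decr_i r k hr h k2
              omega
          obtain ⟨g1, g2⟩ := (ih k hkr k1 k2 x).1 f'
          exact h5 k k1 hkr g1 g2
        · omega
      have hinf : sInf (setA i j (posArrows (arrows m)) r) = u :=
        le_antisymm (Nat.sInf_le hmem) (hmin _ (Nat.sInf_mem ⟨u, hmem⟩))
      rw [hinf]
      constructor
      · intro h
        exact ⟨⟨u, hmem⟩, (Dot.top.inj h).symm⟩
      · rintro ⟨-, rfl⟩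
        rfl
    · constructor
      · intro h
        cases h
      · rintro ⟨⟨x, hx⟩, -⟩
        exact absurd (top_mem_tails_posArrows.2 ⟨u, by omega, e⟩) ((hc.mem_setA hr hrp).1 hx).1

theorem topArrows_eq : topArrows (arrows m) = {a | ∃ r, 1 ≤ r ∧ r ≤ p ∧
    (setA i j (posArrows (arrows m)) r).Nonempty ∧
    a = (.top (i r), .top (sInf (setA i j (posArrows (arrows m)) r)))} := by
  ext a
  rw [mem_topArrows_arrows]
  constructor
  · rintro ⟨x, y, hxy, h, rfl⟩
    obtain ⟨r, r1, r2, rfl⟩ := (hc.oriented.top_iff x).1 (by rw [h]; simp only [Dot.key]; omega)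
    obtain ⟨h1, h2⟩ := (hc.apply_top_iff r1 r2 y).1 h
    exact ⟨r, r1, r2, h1, by rw [← h2]⟩
  · rintro ⟨r, r1, r2, h, rfl⟩
    have h1 := (hc.apply_top_iff r1 r2 _).2 ⟨h, rfl⟩
    have h2 := (hc.oriented.top_iff (i r)).2 ⟨r, r1, r2, rfl⟩
    rw [h1] at h2
    simp only [Dot.key] at h2
    exact ⟨_, _, by omega, h1, rfl⟩

theorem mem_setB {r x : ℕ} (hrp : r ≤ p) :
    x ∈ setB p i j (posArrows (arrows m)) r ↔
      Dot.bot (j r + 1) ∉ heads (posArrows (arrows m)) ∧ i p ≤ x ∧ x ≤ j r ∧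
      (∀ k, r < k → k ≤ p → x ≠ j k + 1) ∧
      (∀ k, r < k → k ≤ p → (setB p i j (posArrows (arrows m)) k).Nonempty →
        x ≠ sSup (setB p i j (posArrows (arrows m)) k)) := by
  rw [setB]
  split_ifs with h
  · subst h
    -- A positive head has index `t < s ≤ p`, so the special clause for `r = p` agrees with the
    -- general one.
    have h1 : Dot.bot (j r + 1) ∉ heads (posArrows (arrows m)) := by
      rw [bot_mem_heads_posArrows]
      rintro ⟨y, h1, h2⟩
      obtain ⟨t, s, t1, hts, s2, -, e⟩ := hc.exists_of_positive h1 h2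
      have := hc.pair.decr_j t r t1 (by omega) le_rfl
      omega
    constructor
    · rintro ⟨h2, h3⟩
      exact ⟨h1, h2, h3, fun k _ _ => by omega, fun k _ _ => by omega⟩
    · rintro ⟨-, h2, h3, -⟩
      exact ⟨h2, h3⟩
  · constructor
    · rintro ⟨h1, ⟨h2, h3⟩, h4, h5⟩
      exact ⟨h1, h2, h3, h4, fun k k1 k2 => h5 k ⟨k1, k2⟩⟩
    · rintro ⟨h1, h2, h3, h4, h5⟩
      exact ⟨h1, ⟨h2, h3⟩, h4, fun k hk => h5 k hk.1 hk.2⟩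

/-- The string at `bot (j r + 1)` starts in the bottom row at `v` if and only if
`v = max B(r)`. -/
theorem apply_bot_iff {r : ℕ} (hr : 1 ≤ r) (hrp : r ≤ p) (v : ℕ) :
    m (.bot (j r + 1)) = .bot v ↔ (setB p i j (posArrows (arrows m)) r).Nonempty ∧
      v = sSup (setB p i j (posArrows (arrows m)) r) := by
  induction hd : p - r using Nat.strong_induction_on generalizing r v with
  | _ d ih' =>
    have ih : ∀ k, r < k → k ≤ p → ∀ v, m (.bot (j k + 1)) = .bot v ↔
        (setB p i j (posArrows (arrows m)) k).Nonempty ∧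
        v = sSup (setB p i j (posArrows (arrows m)) k) :=
      fun k k1 k2 v => ih' (p - k) (by omega) (by omega) k2 v rfl
    clear ih' hd
    have hJ : ∀ {x : ℕ}, (m (.bot x)).key < (Dot.bot x).key → ∃ k, 1 ≤ k ∧ k ≤ p ∧ x = j k + 1 := by
      intro x h
      obtain ⟨_, ⟨k, k1, k2, rfl⟩, rfl⟩ := (hc.oriented.bot_iff x).1 h
      exact ⟨k, k1, k2, rfl⟩
    have br := hc.pair.bounds r hr hrp
    have hright := (hc.oriented.bot_iff (j r + 1)).2 ⟨j r, ⟨r, hr, hrp, rfl⟩, rfl⟩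
    have hon := hc.matching.isOn_apply
      (isOn_bot (by omega) (by omega) : (Dot.bot (j r + 1)).IsOn n)
    rcases e : m (.bot (j r + 1)) with u | u <;> rw [e] at hright hon <;>
      simp only [Dot.key, Dot.IsOn, Dot.num] at hright hon
    · constructor
      · intro h
        cases h
      · rintro ⟨⟨x, hx⟩, -⟩
        exact absurd (bot_mem_heads_posArrows.2
          ⟨u, by omega, by rw [← e, hc.matching.invol]⟩) ((hc.mem_setB hrp).1 hx).1
    · have e' : m (.bot u) = .bot (j r + 1) := by rw [← e, hc.matching.invol]
      have hu : ¬ (m (.bot u)).key < (Dot.bot u).key := by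
        rw [e']
        simp only [Dot.key]
        omega
      have hmem : u ∈ setB p i j (posArrows (arrows m)) r := by
        rw [hc.mem_setB hrp]
        refine ⟨?_, ?_, by omega, ?_, ?_⟩
        · rw [bot_mem_heads_posArrows]
          rintro ⟨y, -, h⟩
          have := hc.matching.injective (h.trans e'.symm)
          cases this
        · by_contra h
          -- Left of `i p` all strings are vertical, which gives the lower bound in `B(r)`.
          have := hc.oriented.apply_top_of_lt hc.matching (b := u) (x := u) (by
            rintro _ ⟨k, k1, k2, rfl⟩
            rcases k2.lt_or_eq with hk | rfl
            · have := hc.pair.decr_i k p k1 hk le_rfl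
              omega
            · omega) hon.1 le_rfl hon.2
          have h2 := hc.matching.invol (.top u)
          rw [this, e'] at h2
          cases h2
        · rintro k k1 k2 rfl
          exact hu ((hc.oriented.bot_iff _).2 ⟨j k, ⟨k, by omega, k2, rfl⟩, rfl⟩)
        · rintro k k1 k2 h1 h2
          have := (ih k k1 k2 u).2 ⟨h1, h2⟩
          have h3 := Dot.bot.inj (hc.matching.injective (this.trans e.symm))
          have := hc.pair.decr_j r k hr k1 k2
          omega
      have hmax : ∀ x ∈ setB p i j (posArrows (arrows m)) r, x ≤ u := by
        intro x hx
        obtain ⟨-, -, h2, h4, h5⟩ := (hc.mem_setB hrp).1 hx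
        by_contra hxu
        have hnest := hc.matching.nested (.bot (j r + 1)) (.bot x)
          (by simp only [Dot.pos]; push_cast; omega) (by rw [e]; simp only [Dot.pos]; omega)
        have hxon : (Dot.bot x).IsOn n := isOn_bot (by omega) (by omega)
        have hleft := (hc.matching.key_lt_or_lt hxon).resolve_right fun h => by
          obtain ⟨k, k1, k2, rfl⟩ := hJ h
          refine h4 k ?_ k2 rfl
          rcases lt_trichotomy k r with h | h | h
          · have := hc.pair.decr_j k r k1 h hrp
            omega
          · rw [h] at h2
            omega
          · exact h
        have hmon := hc.matching.isOn_apply hxon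
        rw [e] at hnest
        rcases f : m (.bot x) with w | w <;> rw [f] at hnest hleft hmon <;>
          simp only [Dot.pos, Dot.key, Dot.IsOn, Dot.num] at hnest hleft hmon
        · push_cast at hnest
          omega
        · have f' : m (.bot w) = .bot x := by rw [← f, hc.matching.invol]
          obtain ⟨k, k1, k2, rfl⟩ := hJ (x := w) (by rw [f']; simp only [Dot.key]; omega)
          have hrk : r < k := by
            push_cast at hnest
            rcases lt_trichotomy k r with h | h | h
            · have := hc.pair.decr_j k r k1 h hrp
              omega
            · rw [h] at hnest
              omega
            · exact h
          obtain ⟨g1, g2⟩ := (ih k hrk k2 x).1 f'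
          exact h5 k hrk k2 g1 g2
      -- `hmax` also supplies the bound without which `sSup` on the natural numbers need not be a
      -- maximum.
      have hsup : sSup (setB p i j (posArrows (arrows m)) r) = u :=
        le_antisymm (csSup_le ⟨u, hmem⟩ hmax) (le_csSup ⟨u, hmax⟩ hmem)
      rw [hsup]
      constructor
      · intro h
        exact ⟨⟨u, hmem⟩, (Dot.bot.inj h).symm⟩
      · rintro ⟨-, rfl⟩
        rfl

theorem botArrows_eq : botArrows (arrows m) = {a | ∃ r, 1 ≤ r ∧ r ≤ p ∧
    (setB p i j (posArrows (arrows m)) r).Nonempty ∧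
    a = (.bot (sSup (setB p i j (posArrows (arrows m)) r)), .bot (j r + 1))} := by
  ext a
  rw [mem_botArrows_arrows]
  constructor
  · rintro ⟨x, y, hxy, h, rfl⟩
    have h' : m (.bot y) = .bot x := by rw [← h, hc.matching.invol]
    obtain ⟨_, ⟨r, r1, r2, rfl⟩, rfl⟩ := (hc.oriented.bot_iff y).1 (by
      rw [h']; simp only [Dot.key]; omega)
    obtain ⟨h1, h2⟩ := (hc.apply_bot_iff r1 r2 x).1 h'
    exact ⟨r, r1, r2, h1, by rw [← h2]⟩
  · rintro ⟨r, r1, r2, h, rfl⟩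
    have h1 := (hc.apply_bot_iff r1 r2 _).2 ⟨h, rfl⟩
    have h2 := (hc.oriented.bot_iff (j r + 1)).2 ⟨j r, ⟨r, r1, r2, rfl⟩, rfl⟩
    rw [h1] at h2
    simp only [Dot.key] at h2
    exact ⟨_, _, by omega, by rw [← h1, hc.matching.invol], rfl⟩

end IsCanonical

end FCDiagram

/-! ### Transfer to the diagram of the canonical word -/

theorem mainTheorem2 (n : ℕ) {W : Type*} [Group W] (cs : CoxeterSystem (CoxeterMatrix.A n) W)
    (p : ℕ) (i j : ℕ → ℕ) (hij : FCDiagram.IsStandardPair n p i j)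
    (D : Set FCDiagram.Arrow) (hD : D = FCDiagram.diagram n p i j) :
    FCDiagram.IsDiagram n D ∧
    FCDiagram.setI n D = {x | ∃ k, 1 ≤ k ∧ k ≤ p ∧ x = i k} ∧
    FCDiagram.setJ n D = {x | ∃ k, 1 ≤ k ∧ k ≤ p ∧ x = j k} ∧
    FCDiagram.posArrows D =
      {a | ∃ t s, 1 ≤ t ∧ t < s ∧ s ≤ p ∧ FCDiagram.PositiveRule cs i j t s ∧
        a = (.top (i s), .bot (j t + 1))} ∧
    FCDiagram.topArrows D =
      {a | ∃ r, 1 ≤ r ∧ r ≤ p ∧ (FCDiagram.setA i j (FCDiagram.posArrows D) r).Nonempty ∧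
        a = (.top (i r), .top (sInf (FCDiagram.setA i j (FCDiagram.posArrows D) r)))} ∧
    FCDiagram.botArrows D =
      {a | ∃ r, 1 ≤ r ∧ r ≤ p ∧ (FCDiagram.setB p i j (FCDiagram.posArrows D) r).Nonempty ∧
        a = (.bot (sSup (FCDiagram.setB p i j (FCDiagram.posArrows D) r)), .bot (j r + 1))} := by
  obtain ⟨m, hm, ho, h⟩ := FCDiagram.exists_matching_diagram hij
  have hc : FCDiagram.IsCanonical n p i j m := ⟨hij, hm, ho⟩
  rw [h] at hD
  subst hD
  exact ⟨hm.isDiagram, hc.setI_eq, hc.setJ_eq, hc.posArrows_eq cs, hc.topArrows_eq, hc.botArrows_eq⟩
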